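/- Let $k:(0,\infty)\to[0,\infty)$ be a function whose Laplace transform $K(p)=\int_0^\infty e^{-pt}k(t)\,dt$ exists for all $p>0$, and suppose that (*) $K$ is a Stieltjes function, that is $K(p)=\frac ap+b+\int_{[0,\infty)}\frac{\sigma(dt)}{p+t}$ for $p>0$, with $a,b\ge 0$ and a Borel measure $\sigma$ on $[0,\infty)$ such that $\int_{[0,\infty)}\frac{\sigma(dt)}{1+t}<\infty$; and $K(p)\to\infty$, $pK(p)\to 0$ as $p\to 0+$; $K(p)\to 0$, $pK(p)\to\infty$ as $p\to\infty$. Write $(g*h)(t)=\int_0^t g(t-s)h(s)\,ds$, and let $(D_{(k)}u)(t)=\frac{d}{dt}(k*u)(t)-k(t)u(0)$, which is defined for functions $u$ continuous on $[0,\infty)$ such that $k*u$ is differentiable almost everywhere on $(0,\infty)$. Then $p\mapsto \frac1{pK(p)}$ is a Stieltjes function, and there is a function $\varkappa$, completely monotone on $(0,\infty)$, such that, for some Borel measure $\eta$ on $[0,\infty)$ with $\int_{[0,\infty)}\frac{\eta(d\lambda)}{1+\lambda}<\infty$, $$\frac1{pK(p)}=\int_{[0,\infty)}\frac{\eta(d\lambda)}{p+\lambda}=\int_0^\infty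 e^{-ps}\varkappa(s)\,ds\quad(p>0),\qquad \varkappa(t)=\int_{[0,\infty)}e^{-\lambda t}\,\eta(d\lambda)\quad(t>0),$$ $$(k*\varkappa)(t)=1\quad\text{for all } t>0 \quad\text{(so $k$ and $\varkappa$ form a Sonine pair)},$$ and the operator $I_{(k)}f=\varkappa*f$ has the following properties. (i) If $f$ is measurable on $(0,\infty)$ and bounded on $(0,T]$ for every $T>0$, then $(I_{(k)}f)(t)$ exists for every $t>0$; with the value $0$ at $t=0$, the function $I_{(k)}f$ belongs to the domain of $D_{(k)}$; and $D_{(k)}I_{(k)}f=f$ almost everywhere on $(0,\infty)$. (ii) If $u$ is absolutely continuous on $[0,T]$ for every $T>0$, then $u$ belongs to the domain of $D_{(k)}$, $D_{(k)}u$ is integrable on $(0,T]$ for every $T>0$, and for every $t\ge 0$ the integral $(I_{(k)}D_{(k)}u)(t)$ exists and equals $u(t)-u(0)$. -/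

import Mathlib

open MeasureTheory Set Filter Topology
open scoped ContDiff

namespace GenFrac

/-- A function `f` is completely monotone on `(0, ∞)`: it is infinitely differentiable there and
`(-1)^n f^{(n)}(t) ≥ 0` for all `t > 0` and all `n`. -/
def CompletelyMonotone (f : ℝ → ℝ) : Prop :=
  ContDiffOn ℝ ∞ f (Ioi 0) ∧
    ∀ (n : ℕ) (t : ℝ), 0 < t → 0 ≤ (-1 : ℝ) ^ n * iteratedDeriv n f t

/-- A function `φ` on `(0, ∞)` belongs to the Stieltjes class:
`φ(p) = a/p + b + ∫_{[0,∞)} σ(dt)/(p+t)` with `a, b ≥ 0` and a Borel measure `σ` on `[0, ∞)`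
such that `∫_{[0,∞)} σ(dt)/(1+t) < ∞`. -/
def IsStieltjes (φ : ℝ → ℝ) : Prop :=
  ∃ (a b : ℝ) (σ : Measure ℝ), 0 ≤ a ∧ 0 ≤ b ∧
    IntegrableOn (fun t : ℝ => (1 + t)⁻¹) (Ici 0) σ ∧
    ∀ p : ℝ, 0 < p → φ p = a / p + b + ∫ t in Ici (0 : ℝ), (p + t)⁻¹ ∂σ

/-- The Laplace transform `∫_0^∞ e^{-pt} k(t) dt`. -/
noncomputable def laplace (k : ℝ → ℝ) (p : ℝ) : ℝ :=
  ∫ t in Ioi (0 : ℝ), Real.exp (-p * t) * k t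

/-- The Laplace transform of `k` exists (as a Lebesgue integral) for all `p > 0`. -/
def HasLaplace (k : ℝ → ℝ) : Prop :=
  ∀ p : ℝ, 0 < p → IntegrableOn (fun t : ℝ => Real.exp (-p * t) * k t) (Ioi 0)

/-- The standing assumptions on the kernel `k`, a nonnegative function on `(0, ∞)`. Existence of
the Laplace transform contains measurability and local integrability on `[0, ∞)`. -/
structure Admissible (k : ℝ → ℝ) : Prop where
  nonneg : ∀ t : ℝ, 0 < t → 0 ≤ k t
  hasLaplace : HasLaplace k
  stieltjes : IsStieltjes (laplace k)
  laplace_zero : Tendsto (laplace k) (𝓝[>] 0) atTop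
  laplace_top : Tendsto (laplace k) atTop (𝓝 0)
  mul_laplace_zero : Tendsto (fun p : ℝ => p * laplace k p) (𝓝[>] 0) (𝓝 0)
  mul_laplace_top : Tendsto (fun p : ℝ => p * laplace k p) atTop atTop

/-- The convolution `(k * u)(t) = ∫_0^t k(t-s) u(s) ds` on the half-line; only `t ≥ 0` matters. -/
noncomputable def conv (k u : ℝ → ℝ) (t : ℝ) : ℝ :=
  ∫ s in (0 : ℝ)..t, k (t - s) * u s

/-- The domain of the generalized fractional derivative: continuous functions `u` on `[0, ∞)` for
which `k * u` is almost everywhere differentiable on `(0, ∞)`. -/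
def InDomain (k u : ℝ → ℝ) : Prop :=
  ContinuousOn u (Ici 0) ∧
    ∀ᵐ t ∂(volume.restrict (Ioi (0 : ℝ))), DifferentiableAt ℝ (conv k u) t

/-- The generalized fractional derivative
`(D_(k) u)(t) = d/dt ∫_0^t k(t-s) u(s) ds - k(t) u(0)`. -/
noncomputable def fracDeriv (k u : ℝ → ℝ) (t : ℝ) : ℝ :=
  deriv (conv k u) t - k t * u 0

/-- The generalized fractional integral `(I_(k) f)(t) = ∫_0^t ϰ(t-s) f(s) ds`. -/
noncomputable def fracInt (ϰ f : ℝ → ℝ) : ℝ → ℝ :=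
  conv ϰ f

/-- `f` is locally bounded and (Lebesgue) measurable on the half-line `(0, ∞)`: it is bounded on
`(0, T]` for every finite `T`. -/
def LocBddMeasurable (f : ℝ → ℝ) : Prop :=
  AEStronglyMeasurable f (volume.restrict (Ioi 0)) ∧
    ∀ T : ℝ, 0 < T → ∃ C : ℝ, ∀ t ∈ Ioc 0 T, |f t| ≤ C

/-- `u` is absolutely continuous on `[0, ∞)`, that is, on every `[0, T]`. -/
def AbsContHalfLine (u : ℝ → ℝ) : Prop :=
  ∀ T : ℝ, 0 < T → AbsolutelyContinuousOnInterval u 0 T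

end GenFrac

/-! Write `K(p) = ∫ σ(ds)/(p+s)`: since `K → 0` at infinity there is no constant term, and `a/p` is
an atom of `σ` at `0`. If `σ` is a finite sum of atoms at positive points, the imaginary part of `K`
shows that its zeros are real, and they are negative and simple. The signs of the residues then give
`1/(pK(p))` a partial fraction expansion with nonnegative coefficients (`exists_partialFractions`).

The general case follows by compactness. The substitution `x = s/(1+s)` and the normalisation `K(1)
= 1` turn the measures into probability measures on `[0,1]`. There the relation `p K K' = 1` passes
to weak limits (`exists_dual`). Mass of the dual measure at `x = 1` becomes a constant term, which
`pK(p) → ∞` excludes. Thus `1/(pK(p)) = ∫ η(ds)/(p+s)`.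

Put `ϰ(t) = ∫ e^{-ts} η(ds)`. By uniqueness of the Laplace transform (`ae_eq_of_laplace_eq`), `k`
agrees almost everywhere with the exponential integral of `σ`, and `k * ϰ`, whose transform is
`1/p`, equals `1` almost everywhere. Monotonicity upgrades this to every `t > 0`
(`conv_eq_one_of_ae`).

The calculus is associativity of convolution (`conv_assoc`). From `k * (ϰ * f) = 1 * f`,
differentiation returns `f`. For absolutely continuous `u`, `D u = k * u'` almost everywhere, so `ϰ
* D u = 1 * u' = u - u(0)`. -/

namespace GenFrac

/-! ### Finite sums: partial fractions of `1/(pK(p))` -/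

section PartialFractions

open Polynomial

variable {ι : Type*} [DecidableEq ι]

/-- The numerator of `∑ i, w i / (X - t i)` over the common denominator `∏ i, (X - t i)`. -/
noncomputable def fractionNumerator (s : Finset ι) (t w : ι → ℝ) : ℝ[X] :=
  ∑ i ∈ s, C (w i) * Lagrange.nodal (s.erase i) t

/-- The target field is general so that real roots (`RingHom.id ℝ`) and complex ones
(`Complex.ofRealHom`) are treated together. -/
lemma eval₂_fractionNumerator {F : Type*} [Field F] (φ : ℝ →+* F) (s : Finset ι) (t w : ι → ℝ)
    (z : F) (hz : ∀ i ∈ s, z ≠ φ (t i)) :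
    (fractionNumerator s t w).eval₂ φ z =
      (∏ i ∈ s, (z - φ (t i))) * ∑ i ∈ s, φ (w i) * (z - φ (t i))⁻¹ := by
  simp only [fractionNumerator, eval₂_finsetSum, eval₂_mul, eval₂_C, Finset.mul_sum]
  refine Finset.sum_congr rfl fun i hi => ?_
  rw [Lagrange.nodal_eq, eval₂_finsetProd, ← Finset.mul_prod_erase s _ hi]
  simp only [eval₂_sub, eval₂_X, eval₂_C]
  have := sub_ne_zero.2 (hz i hi)
  field_simp

lemma eval₂_fractionNumerator_node {F : Type*} [Field F] (φ : ℝ →+* F) (s : Finset ι)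
    (t w : ι → ℝ) {i : ι} (hi : i ∈ s) :
    (fractionNumerator s t w).eval₂ φ (φ (t i)) =
      φ (w i) * ∏ j ∈ s.erase i, (φ (t i) - φ (t j)) := by
  simp only [fractionNumerator, eval₂_finsetSum, eval₂_mul, eval₂_C]
  rw [Finset.sum_eq_single_of_mem i hi]
  · rw [Lagrange.nodal_eq, eval₂_finsetProd]
    simp
  · intro j hj hji
    rw [Lagrange.nodal_eq, eval₂_finsetProd,
      Finset.prod_eq_zero (Finset.mem_erase.2 ⟨hji.symm, hi⟩) (by simp), mul_zero]

/-- At a node only one summand survives: its weight times a product of nonzero differences of nodes.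
-/
lemma ne_node_of_fractionNumerator_root {F : Type*} [Field F] (φ : ℝ →+* F) {s : Finset ι}
    {t w : ι → ℝ} (ht : Set.InjOn t s) (hw : ∀ i ∈ s, 0 < w i) {z : F}
    (hz : (fractionNumerator s t w).eval₂ φ z = 0) : ∀ i ∈ s, z ≠ φ (t i) := by
  rintro i hi rfl
  rw [eval₂_fractionNumerator_node φ s t w hi, mul_eq_zero, Finset.prod_eq_zero_iff] at hz
  rcases hz with h | ⟨j, hj, h⟩
  · exact (hw i hi).ne' ((map_eq_zero φ).1 h)
  · rw [Finset.mem_erase] at hj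
    exact hj.1 (ht hj.2 hi (φ.injective (sub_eq_zero.1 h).symm))

lemma sum_eq_zero_of_fractionNumerator_root {F : Type*} [Field F] (φ : ℝ →+* F) {s : Finset ι}
    {t w : ι → ℝ} (ht : Set.InjOn t s) (hw : ∀ i ∈ s, 0 < w i) {z : F}
    (hz : (fractionNumerator s t w).eval₂ φ z = 0) :
    ∑ i ∈ s, φ (w i) * (z - φ (t i))⁻¹ = 0 := by
  have hne := ne_node_of_fractionNumerator_root φ ht hw hz
  rw [eval₂_fractionNumerator φ s t w z hne, mul_eq_zero, Finset.prod_eq_zero_iff] at hz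
  rcases hz with ⟨j, hj, h⟩ | h
  · exact absurd (sub_eq_zero.1 h) (hne j hj)
  · exact h

/-- At a complex root `z`, the imaginary part of `∑ w i/(z - t i)` is `-Im z` times a positive sum,
so `z` is real. -/
lemma splits_fractionNumerator {s : Finset ι} (hs : s.Nonempty)
    {t w : ι → ℝ} (ht : Set.InjOn t s) (hw : ∀ i ∈ s, 0 < w i) :
    (fractionNumerator s t w).Splits := by
  refine Splits.of_splits_map Complex.ofRealHom (IsAlgClosed.splits _) fun z hz => ?_
  have hz0 : (fractionNumerator s t w).eval₂ Complex.ofRealHom z = 0 := by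
    rw [← eval_map]; exact isRoot_of_mem_roots hz
  have hne := ne_node_of_fractionNumerator_root _ ht hw hz0
  have hsum := congrArg Complex.im (sum_eq_zero_of_fractionNumerator_root _ ht hw hz0)
  have him : z.im * ∑ i ∈ s, w i / Complex.normSq (z - t i) = 0 := by
    rw [Complex.im_sum] at hsum
    rw [Finset.mul_sum, ← neg_eq_zero, ← Finset.sum_neg_distrib]
    refine Eq.trans (Finset.sum_congr rfl fun i _ => ?_) hsum
    simp [Complex.inv_im]
    ring
  have hpos : 0 < ∑ i ∈ s, w i / Complex.normSq (z - t i) :=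
    Finset.sum_pos (fun i hi => div_pos (hw i hi)
      (Complex.normSq_pos.2 (sub_ne_zero.2 (hne i hi)))) hs
  have h0 : z.im = 0 := (mul_eq_zero.1 him).resolve_right hpos.ne'
  exact ⟨z.re, by apply Complex.ext <;> simp [h0]⟩

lemma fractionNumerator_root_pos {s : Finset ι} (hs : s.Nonempty)
    {t w : ι → ℝ} (ht : Set.InjOn t s) (hpos : ∀ i ∈ s, 0 < t i) (hw : ∀ i ∈ s, 0 < w i) {z : ℝ}
    (hz : (fractionNumerator s t w).eval z = 0) : 0 < z := by
  by_contra! hz0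
  have h := sum_eq_zero_of_fractionNumerator_root (RingHom.id ℝ) ht hw hz
  simp only [RingHom.id_apply] at h
  refine (Finset.sum_neg (fun i hi => ?_) hs).ne h
  exact mul_neg_of_pos_of_neg (hw i hi) (inv_lt_zero.2 (by linarith [hpos i hi]))

/-- Near `z` the numerator is `Q h` with `h(z) = 0`, so its derivative at `z` is `Q(z) h'(z)`. This
yields both simplicity of the roots and the signs of the residues. -/
lemma derivative_fractionNumerator_root {s : Finset ι}
    {t w : ι → ℝ} (ht : Set.InjOn t s) (hw : ∀ i ∈ s, 0 < w i) {z : ℝ}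
    (hz : (fractionNumerator s t w).eval z = 0) :
    (derivative (fractionNumerator s t w)).eval z =
      - ((Lagrange.nodal s t).eval z * ∑ i ∈ s, w i * ((z - t i) ^ 2)⁻¹) := by
  have hne := ne_node_of_fractionNumerator_root (RingHom.id ℝ) ht hw hz
  have hsum := sum_eq_zero_of_fractionNumerator_root (RingHom.id ℝ) ht hw hz
  simp only [RingHom.id_apply] at hne hsum
  have h1 : HasDerivAt (fun y => ∑ i ∈ s, w i * (y - t i)⁻¹)
      (∑ i ∈ s, w i * (-1 / (z - t i) ^ 2)) z := by
    refine HasDerivAt.fun_sum fun i hi => ?_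
    exact (((hasDerivAt_id z).sub_const (t i)).inv (sub_ne_zero.2 (hne i hi))).const_mul (w i)
  have h2 := ((Lagrange.nodal s t).hasDerivAt z).mul h1
  have hev : (fun y => (fractionNumerator s t w).eval y) =ᶠ[𝓝 z]
      ((fun y => (Lagrange.nodal s t).eval y) * fun y => ∑ i ∈ s, w i * (y - t i)⁻¹) := by
    have : ∀ᶠ y in 𝓝 z, ∀ i ∈ s, y ≠ t i :=
      (Filter.eventually_all_finset s).2 fun i hi => isOpen_ne.mem_nhds (hne i hi)
    filter_upwards [this] with y hy
    have := eval₂_fractionNumerator (RingHom.id ℝ) s t w y hy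
    simpa [eval₂_id, Lagrange.eval_nodal] using this
  rw [((fractionNumerator s t w).hasDerivAt z).unique (h2.congr_of_eventuallyEq hev), hsum,
    mul_zero, zero_add, ← mul_neg, ← Finset.sum_neg_distrib]
  congr 1
  refine Finset.sum_congr rfl fun i _ => ?_
  rw [neg_div, one_div, mul_neg]

lemma coeff_fractionNumerator {s : Finset ι} {t w : ι → ℝ} :
    (fractionNumerator s t w).coeff (s.card - 1) = ∑ i ∈ s, w i := by
  simp only [fractionNumerator, finsetSum_coeff, coeff_C_mul]
  refine Finset.sum_congr rfl fun i hi => ?_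
  have h := (Lagrange.nodal_monic (s := s.erase i) (v := t)).coeff_natDegree
  rw [Lagrange.natDegree_nodal, Finset.card_erase_of_mem hi] at h
  rw [h, mul_one]

lemma natDegree_fractionNumerator {s : Finset ι} (hs : s.Nonempty) {t w : ι → ℝ}
    (hw : ∀ i ∈ s, 0 < w i) : (fractionNumerator s t w).natDegree = s.card - 1 := by
  apply natDegree_eq_of_le_of_coeff_ne_zero
  · refine natDegree_sum_le_of_forall_le _ _ fun i hi => ?_
    refine (natDegree_C_mul_le _ _).trans ?_
    rw [Lagrange.natDegree_nodal, Finset.card_erase_of_mem hi]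
  · rw [coeff_fractionNumerator]
    exact (Finset.sum_pos hw hs).ne'

/-- If `K(p) = ∑ w i / (p + t i)` is a finite sum with positive weights and distinct positive
nodes, then the partial fraction expansion of `1 / (p K(p))` has nonnegative coefficients and
poles in `(-∞, 0]`. -/
theorem exists_partialFractions {s : Finset ι} (hs : s.Nonempty) {t w : ι → ℝ}
    (ht : Set.InjOn t s) (hpos : ∀ i ∈ s, 0 < t i) (hw : ∀ i ∈ s, 0 < w i) :
    ∃ (c : ℝ) (R : Finset ℝ) (d : ℝ → ℝ), 0 ≤ c ∧ (∀ r ∈ R, 0 ≤ r ∧ 0 ≤ d r) ∧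
      ∀ p : ℝ, 0 < p →
        1 / (p * ∑ i ∈ s, w i * (p + t i)⁻¹) = c + ∑ r ∈ R, d r * (p + r)⁻¹ := by
  set P := fractionNumerator s t w with hP
  set Q := Lagrange.nodal s t with hQ
  set W := ∑ i ∈ s, w i with hW
  have hWpos : 0 < W := Finset.sum_pos hw hs
  have hdeg : P.natDegree = s.card - 1 := natDegree_fractionNumerator hs hw
  have hlead : P.leadingCoeff = W := by
    rw [leadingCoeff, hdeg, hP, coeff_fractionNumerator]
  have hP0 : P ≠ 0 := by
    rw [← leadingCoeff_ne_zero, hlead]; exact hWpos.ne'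
  have hsplit : P.Splits := splits_fractionNumerator hs ht hw
  have hroot : ∀ z ∈ P.roots, P.eval z = 0 := fun z hz => (mem_roots hP0).1 hz
  have hrpos : ∀ z ∈ P.roots, 0 < z := fun z hz =>
    fractionNumerator_root_pos hs ht hpos hw (hroot z hz)
  have hQne : ∀ z ∈ P.roots, Q.eval z ≠ 0 := fun z hz => by
    rw [hQ, Lagrange.eval_nodal, Finset.prod_ne_zero_iff]
    exact fun i hi => sub_ne_zero.2
      (ne_node_of_fractionNumerator_root (RingHom.id ℝ) ht hw (hroot z hz) i hi)
  have hsq : ∀ z ∈ P.roots, 0 < ∑ i ∈ s, w i * ((z - t i) ^ 2)⁻¹ := fun z hz =>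
    Finset.sum_pos (fun i hi => mul_pos (hw i hi) (inv_pos.2 (by
      have := sub_ne_zero.2
        (ne_node_of_fractionNumerator_root (RingHom.id ℝ) ht hw (hroot z hz) i hi)
      simp only [RingHom.id_apply] at this
      positivity))) hs
  have hder : ∀ z ∈ P.roots, (derivative P).eval z =
      - (Q.eval z * ∑ i ∈ s, w i * ((z - t i) ^ 2)⁻¹) := fun z hz =>
    derivative_fractionNumerator_root ht hw (hroot z hz)
  have hnodup : P.roots.Nodup := by
    rw [Multiset.nodup_iff_count_le_one]
    intro z
    by_cases hz : z ∈ P.roots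
    · rw [count_roots]
      by_contra! hlt
      have := ((one_lt_rootMultiplicity_iff_isRoot hP0).1 hlt).2
      rw [IsRoot, hder z hz, neg_eq_zero, mul_eq_zero] at this
      exact this.elim (hQne z hz) (hsq z hz).ne'
    · rw [Multiset.count_eq_zero_of_notMem hz]; exact zero_le_one
  have h0 : (0 : ℝ) ∉ P.roots.toFinset := fun h =>
    lt_irrefl _ (hrpos 0 (Multiset.mem_toFinset.1 h))
  -- With `z = -p` one has `K(p) = -P(z)/Q(z)`, hence `1/(pK(p)) = Q(z)/(z P(z))`. The poles in `z`
  -- are therefore `0` and the roots of `P`.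
  set R : Finset ℝ := insert 0 P.roots.toFinset with hR
  set N := Lagrange.nodal R id with hN
  have hcard : R.card = s.card := by
    rw [hR, Finset.card_insert_of_notMem h0, Multiset.toFinset_card_of_nodup hnodup,
      ← hsplit.natDegree_eq_card_roots, hdeg]
    have := hs.card_pos
    omega
  have hXP : X * P = C W * N := by
    rw [hN, hR, Lagrange.nodal_insert_eq_nodal h0, Lagrange.nodal_eq]
    conv_lhs => rw [hsplit.eq_prod_roots, hlead]
    have : (P.roots.map fun a => X - C a).prod = ∏ i ∈ P.roots.toFinset, (X - C (id i)) := by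
      rw [Finset.prod, Multiset.toFinset_val, Multiset.dedup_eq_self.2 hnodup]
      rfl
    rw [this]
    simp only [id, C_0, sub_zero]
    ring
  have hNder : ∀ r, W * (derivative N).eval r = P.eval r + r * (derivative P).eval r := fun r => by
    have := congrArg (fun q => (derivative q).eval r) hXP
    simp only [derivative_mul, derivative_X, derivative_C, eval_add, eval_mul, eval_X,
      eval_C, zero_mul, one_mul, zero_add] at this
    exact this.symm
  -- Up to the factor `1/W` the coefficient of `1/(p+r)` is `-Q(r)/N'(r)`. By `hNder` it equals
  -- `-W/h(0)` with `h(0) < 0` at `r = 0`, and `W/(r S)` with `S > 0` at a root of `P`.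
  have hweight : ∀ r ∈ R, 0 ≤ r ∧ 0 ≤ -(Lagrange.nodalWeight R id r * Q.eval r) := by
    intro r hr
    have hw' : Lagrange.nodalWeight R id r = ((derivative N).eval r)⁻¹ :=
      Lagrange.nodalWeight_eq_eval_derivative_nodal hr
    rw [hw']
    have hd := hNder r
    rcases Finset.mem_insert.1 hr with rfl | hr
    · refine ⟨le_rfl, ?_⟩
      have he := eval₂_fractionNumerator (RingHom.id ℝ) s t w 0 (fun i hi => (hpos i hi).ne)
      simp only [eval₂_id, RingHom.id_apply, ← Lagrange.eval_nodal] at he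
      rw [zero_mul, add_zero, hP, he, ← hQ] at hd
      set h := ∑ i ∈ s, w i * (0 - t i)⁻¹
      have hneg : h < 0 := Finset.sum_neg (fun i hi =>
        mul_neg_of_pos_of_neg (hw i hi) (inv_lt_zero.2 (by linarith [hpos i hi]))) hs
      have hQ0 : Q.eval 0 ≠ 0 := by
        rw [hQ, Lagrange.eval_nodal, Finset.prod_ne_zero_iff]
        exact fun i hi => by simpa using (hpos i hi).ne'
      have hNe : (derivative N).eval 0 = Q.eval 0 * h / W := by
        field_simp; linarith
      rw [hNe]
      have : (Q.eval 0 * h / W)⁻¹ * Q.eval 0 = W / h := by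
        field_simp
      rw [this]
      exact neg_nonneg.2 (div_nonpos_of_nonneg_of_nonpos hWpos.le hneg.le)
    · have hr' := Multiset.mem_toFinset.1 hr
      refine ⟨(hrpos r hr').le, ?_⟩
      rw [hroot r hr', hder r hr', zero_add] at hd
      have hS := hsq r hr'
      set S := ∑ i ∈ s, w i * ((r - t i) ^ 2)⁻¹
      have hQ0 := hQne r hr'
      have hr0 := hrpos r hr'
      have hNe : (derivative N).eval r = -(r * Q.eval r * S / W) := by
        field_simp; linarith
      rw [hNe]
      have : -((-(r * Q.eval r * S / W))⁻¹ * Q.eval r) = W / (r * S) := by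
        field_simp
      rw [this]
      positivity
  refine ⟨1 / W, R, fun r => -(Lagrange.nodalWeight R id r * Q.eval r) / W, by positivity,
    fun r hr => ⟨(hweight r hr).1, div_nonneg (hweight r hr).2 hWpos.le⟩, fun p hp => ?_⟩
  have hx : ∀ i ∈ R, -p ≠ id i := fun i hi h => by
    have := (hweight i hi).1
    simp only [id] at h
    linarith
  -- `Q` and `N` are monic of equal degree, so `Q/N = 1 + (Q - N)/N`, and Lagrange interpolation of
  -- `Q - N` on `R` is its partial fraction expansion.
  have hlt : (Q - N).degree < R.card := by
    have hQd : Q.degree = s.card := Lagrange.degree_nodal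
    have hNd : N.degree = R.card := Lagrange.degree_nodal
    rw [← hcard] at hQd
    rw [← hQd]
    exact degree_sub_lt_left (hQd.trans hNd.symm) Lagrange.nodal_ne_zero
      (Lagrange.nodal_monic.leadingCoeff.trans Lagrange.nodal_monic.leadingCoeff.symm)
  have hint := Lagrange.eq_interpolate (f := Q - N) (v := id) (Set.injOn_id _) hlt
  have hev := congrArg (eval (-p)) hint
  rw [Lagrange.eval_interpolate_not_at_node _ hx, eval_sub, ← hN] at hev
  have hNr : ∀ i ∈ R, eval i (Q - N) = eval i Q := fun i hi => by
    rw [eval_sub, hN, show i = id i from rfl, Lagrange.eval_nodal_at_node hi, sub_zero]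
  have hNp : N.eval (-p) ≠ 0 := Lagrange.eval_nodal_not_at_node hx
  have hsum : ∑ i ∈ R, Lagrange.nodalWeight R id i * (-p - id i)⁻¹ * eval (id i) (Q - N) =
      ∑ r ∈ R, -(Lagrange.nodalWeight R id r * Q.eval r) * (p + r)⁻¹ := by
    refine Finset.sum_congr rfl fun i hi => ?_
    simp only [id]
    rw [hNr i hi, show -p - i = -(p + i) by ring, inv_neg]
    ring
  rw [hsum] at hev
  have hne : ∀ i ∈ s, -p ≠ t i := fun i hi h => by linarith [hpos i hi]
  have he := eval₂_fractionNumerator (RingHom.id ℝ) s t w (-p) hne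
  simp only [eval₂_id, RingHom.id_apply, ← Lagrange.eval_nodal] at he
  have hK : ∑ i ∈ s, w i * (-p - t i)⁻¹ = -∑ i ∈ s, w i * (p + t i)⁻¹ := by
    rw [← Finset.sum_neg_distrib]
    refine Finset.sum_congr rfl fun i _ => ?_
    rw [show -p - t i = -(p + t i) by ring, inv_neg]; ring
  rw [hK] at he
  have hx2 := congrArg (eval (-p)) hXP
  simp only [eval_mul, eval_X, eval_C] at hx2
  rw [hP, he, ← hQ] at hx2
  set K := ∑ i ∈ s, w i * (p + t i)⁻¹
  have hKpos : 0 < K := Finset.sum_pos (fun i hi => mul_pos (hw i hi)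
    (inv_pos.2 (by linarith [hpos i hi]))) hs
  have hfin : ∑ r ∈ R, -(Lagrange.nodalWeight R id r * Q.eval r) / W * (p + r)⁻¹ =
      (∑ r ∈ R, -(Lagrange.nodalWeight R id r * Q.eval r) * (p + r)⁻¹) / W := by
    rw [Finset.sum_div]
    exact Finset.sum_congr rfl fun i _ => by ring
  rw [hfin]
  set S := ∑ r ∈ R, -(Lagrange.nodalWeight R id r * Q.eval r) * (p + r)⁻¹
  have hQW : eval (-p) Q * (p * K) = W * eval (-p) N := by linarith
  have hQN : eval (-p) Q = eval (-p) N * (1 + S) := by linarith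
  have : (1 + S) * (p * K) = W := by
    apply mul_left_cancel₀ hNp
    rw [← mul_assoc, ← hQN, hQW]; ring
  rw [← this]
  have h1S : 1 + S ≠ 0 := fun h => by rw [h, zero_mul] at this; exact hWpos.ne this
  field_simp

end PartialFractions

/-! ### Duality of probability measures on `[0,1]` -/

section Duality

open unitInterval

/-- The Stieltjes kernel `(1 + s) / (p + s)` in the compactified variable `x = s / (1 + s)`. -/
noncomputable def unitKernel (p : ℝ) (x : I) : ℝ := (p * (1 - x) + x)⁻¹

/-- The compactification `s ↦ s / (1 + s)` of the half-line. -/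
noncomputable def toUnit (s : ℝ) : I := projIcc 0 1 zero_le_one (s / (1 + s))

lemma unitKernel_denom_pos {p : ℝ} (hp : 0 < p) (x : I) : 0 < p * (1 - (x : ℝ)) + x := by
  rcases x.2.2.lt_or_eq with h | h
  · have := mul_pos hp (sub_pos.2 h)
    linarith [x.2.1]
  · rw [h]; norm_num

lemma continuous_unitKernel {p : ℝ} (hp : 0 < p) : Continuous (unitKernel p) :=
  Continuous.inv₀ (by fun_prop) fun x => (unitKernel_denom_pos hp x).ne'

/-- Normalisation: at `p = 1` the integral of the kernel is the total mass. -/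
lemma unitKernel_one_left (x : I) : unitKernel 1 x = 1 := by simp [unitKernel]

/-- The endpoint `1` stands for `s = ∞`; an atom there contributes a constant term. -/
lemma unitKernel_one_right (p : ℝ) : unitKernel p 1 = 1 := by simp [unitKernel]

lemma coe_toUnit {s : ℝ} (hs : 0 ≤ s) : (toUnit s : ℝ) = s / (1 + s) := by
  rw [toUnit, projIcc_of_mem zero_le_one
    ⟨by positivity, (div_le_one (by positivity)).2 (by linarith)⟩]

lemma unitKernel_toUnit (p : ℝ) {s : ℝ} (hs : 0 ≤ s) :
    unitKernel p (toUnit s) = (1 + s) * (p + s)⁻¹ := by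
  have h1 : 0 < 1 + s := by positivity
  have h2 : p * (1 - s / (1 + s)) + s / (1 + s) = (p + s) / (1 + s) := by
    field_simp; ring
  rw [unitKernel, coe_toUnit hs, h2, inv_div, div_eq_mul_inv]

lemma measurable_toUnit : Measurable toUnit :=
  continuous_projIcc.measurable.comp (by fun_prop)

lemma integrable_unitKernel {p : ℝ} (hp : 0 < p) (μ : Measure I) [IsFiniteMeasure μ] :
    Integrable (unitKernel p) μ :=
  (BoundedContinuousFunction.mkOfCompact ⟨unitKernel p, continuous_unitKernel hp⟩).integrable μ

/-- The point of the grid `{1 / (n + 2), …, (n + 1) / (n + 2)}` next to `x`. -/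
noncomputable def gridPoint (n : ℕ) (x : I) : I :=
  -- The shifts by `1` and `2` keep the grid off both endpoints, so that the nodes `x/(1-x)` are
  -- positive and finite.
  ⟨(⌊n * (x : ℝ)⌋₊ + 1) / (n + 2), by positivity, by
    have : (⌊n * (x : ℝ)⌋₊ : ℝ) ≤ n * x := Nat.floor_le (by have := x.2.1; positivity)
    have h2 : (n : ℝ) * x ≤ n := mul_le_of_le_one_right (by positivity) x.2.2
    rw [div_le_one (by positivity)]
    linarith⟩

lemma measurable_gridPoint (n : ℕ) : Measurable (gridPoint n) := by
  refine Measurable.subtype_mk ?_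
  have : Measurable fun x : I => ⌊n * (x : ℝ)⌋₊ := Nat.measurable_floor.comp (by fun_prop)
  have h2 : Measurable fun x : I => (⌊n * (x : ℝ)⌋₊ : ℝ) := measurable_from_nat.comp this
  fun_prop

lemma tendsto_gridPoint (x : I) : Tendsto (fun n => gridPoint n x) atTop (𝓝 x) := by
  rw [tendsto_subtype_rng]
  have hinv : Tendsto (fun n : ℕ => 2 / ((n : ℝ) + 2)) atTop (𝓝 0) :=
    tendsto_const_nhds.div_atTop
      (tendsto_atTop_add_const_right _ _ tendsto_natCast_atTop_atTop)
  refine tendsto_iff_dist_tendsto_zero.2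
    (squeeze_zero (fun _ => dist_nonneg) (fun n => ?_) hinv)
  have h0 := x.2.1
  have h1 := x.2.2
  have hf : (⌊n * (x : ℝ)⌋₊ : ℝ) ≤ n * x := Nat.floor_le (by positivity)
  have hf2 : (n * x : ℝ) < ⌊n * (x : ℝ)⌋₊ + 1 := Nat.lt_floor_add_one _
  have hn : (0 : ℝ) < n + 2 := by positivity
  rw [Real.dist_eq, gridPoint]
  simp only
  rw [div_sub' hn.ne', abs_div, abs_of_pos hn]
  gcongr
  rw [abs_le]
  constructor <;> nlinarith

/-- The grid point `x = (j+1)/(n+2)` has node `x/(1-x) = (j+1)/(n+1-j)`, and `1/(1-x) =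
(n+2)/(n+1-j)` is the factor in the weight. -/
lemma integral_unitKernel_gridPoint (μ : Measure I) [IsFiniteMeasure μ] (n : ℕ) (p : ℝ)
    (hp : 0 < p) :
    ∫ x, unitKernel p (gridPoint n x) ∂μ =
      ∑ j ∈ Finset.range (n + 1),
        (μ.real {x | ⌊n * (x : ℝ)⌋₊ = j} * ((n + 2) / (n + 1 - j))) *
          (p + (j + 1) / (n + 1 - j))⁻¹ := by
  have hmeas : ∀ j : ℕ, MeasurableSet {x : I | ⌊n * (x : ℝ)⌋₊ = j} := fun j =>
    (Nat.measurable_floor.comp (by fun_prop : Measurable fun x : I => n * (x : ℝ)))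
      (measurableSet_singleton j)
  have hfun : ∀ x : I, unitKernel p (gridPoint n x) = ∑ j ∈ Finset.range (n + 1),
      {x : I | ⌊n * (x : ℝ)⌋₊ = j}.indicator
        (fun _ => ((n + 2) / (n + 1 - j)) * (p + (j + 1) / (n + 1 - j) : ℝ)⁻¹) x := by
    intro x
    have hmem : ⌊n * (x : ℝ)⌋₊ ∈ Finset.range (n + 1) := by
      rw [Finset.mem_range, Nat.lt_succ_iff]
      refine Nat.floor_le_of_le (mul_le_of_le_one_right (by positivity) x.2.2)
    rw [Finset.sum_eq_single_of_mem _ hmem]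
    · simp only [indicator, mem_ofPred_eq, if_true, unitKernel, gridPoint]
      have hlt : ((⌊n * (x : ℝ)⌋₊ : ℕ) : ℝ) < n + 1 := by
        exact_mod_cast Finset.mem_range.1 hmem
      set j : ℝ := ((⌊n * (x : ℝ)⌋₊ : ℕ) : ℝ) with hj
      have hj0 : 0 ≤ j := Nat.cast_nonneg _
      have h1 : 0 < (n : ℝ) + 1 - j := by linarith
      have h2 : 0 < p * (n + 1 - j) + (j + 1) := by positivity
      have h3 : p * (1 - (j + 1) / (n + 2)) + (j + 1) / (n + 2) =
          (p * (n + 1 - j) + (j + 1)) / (n + 2) := by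
        field_simp; ring
      have h4 : p + (j + 1) / (n + 1 - j) = (p * (n + 1 - j) + (j + 1)) / (n + 1 - j) := by
        field_simp
      rw [h3, h4]
      field_simp
    · intro j _ hj
      rw [indicator_of_notMem]
      exact fun h => hj h.symm
  simp_rw [hfun]
  rw [integral_finsetSum _ fun j _ => (integrable_const _).indicator (hmeas j)]
  refine Finset.sum_congr rfl fun j _ => ?_
  rw [integral_indicator_const _ (hmeas j), smul_eq_mul, mul_assoc]

lemma exists_dual_gridPoint (μ : Measure I) [IsProbabilityMeasure μ] (n : ℕ) :
    ∃ ν : ProbabilityMeasure I, ∀ p : ℝ, 0 < p →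
      p * (∫ x, unitKernel p (gridPoint n x) ∂μ) * ∫ x, unitKernel p x ∂(ν : Measure I) = 1 := by
  set w : ℕ → ℝ := fun j => μ.real {x | ⌊n * (x : ℝ)⌋₊ = j} * ((n + 2) / (n + 1 - j)) with hw
  set t : ℕ → ℝ := fun j => (j + 1) / (n + 1 - j) with ht
  -- Cells of zero mass are dropped, since the partial fraction theorem needs strictly positive
  -- weights.
  set s := (Finset.range (n + 1)).filter fun j => 0 < w j with hs
  have hsub : ∀ j ∈ Finset.range (n + 1), (0 : ℝ) < n + 1 - j := fun j hj => by
    have : (j : ℝ) < n + 1 := by exact_mod_cast Finset.mem_range.1 hj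
    linarith
  have hw0 : ∀ j ∈ Finset.range (n + 1), 0 ≤ w j := fun j hj => by
    have := hsub j hj
    positivity
  have hsum : ∀ p : ℝ, 0 < p → ∫ x, unitKernel p (gridPoint n x) ∂μ =
      ∑ j ∈ s, w j * (p + t j)⁻¹ := fun p hp => by
    rw [integral_unitKernel_gridPoint μ n p hp, hs, Finset.sum_filter_of_ne]
    intro j hj hne
    exact lt_of_le_of_ne (hw0 j hj) fun h => hne (by
      change w j * (p + t j)⁻¹ = 0
      rw [← h, zero_mul])
  have h1 : ∑ j ∈ s, w j * (1 + t j)⁻¹ = 1 := by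
    rw [← hsum 1 one_pos]
    simp [unitKernel_one_left]
  have hne : s.Nonempty := by
    rw [Finset.nonempty_iff_ne_empty]
    intro h
    rw [h, Finset.sum_empty] at h1
    exact zero_ne_one h1
  have hinj : Set.InjOn t s := by
    intro i hi j hj hij
    have hi' := hsub i (Finset.mem_filter.1 hi).1
    have hj' := hsub j (Finset.mem_filter.1 hj).1
    simp only [ht] at hij
    rw [div_eq_div_iff hi'.ne' hj'.ne'] at hij
    have hn : (n : ℝ) + 2 ≠ 0 := by positivity
    have : (i : ℝ) = j := mul_left_cancel₀ hn (by linarith)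
    exact_mod_cast this
  have hpos : ∀ i ∈ s, 0 < t i := fun i hi => by
    have := hsub i (Finset.mem_filter.1 hi).1
    simp only [ht]
    positivity
  obtain ⟨c, R, d, hc, hR, hK⟩ := exists_partialFractions hne hinj hpos
    fun i hi => (Finset.mem_filter.1 hi).2
  -- The constant `c` becomes an atom at `1`; the term `d r/(p+r)` is `d r/(1+r)` times the kernel
  -- at `toUnit r`.
  set ν : Measure I := ENNReal.ofReal c • Measure.dirac 1 +
    ∑ r ∈ R, ENNReal.ofReal (d r * (1 + r)⁻¹) • Measure.dirac (toUnit r) with hν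
  have hfin : IsFiniteMeasure ν := ⟨by
    simp only [hν, Measure.add_apply, Measure.smul_apply, Measure.finsetSum_apply,
      measure_univ, smul_eq_mul, mul_one]
    exact ENNReal.add_lt_top.2 ⟨ENNReal.ofReal_lt_top,
      ENNReal.sum_lt_top.2 fun _ _ => ENNReal.ofReal_lt_top⟩⟩
  have hint : ∀ p : ℝ, 0 < p →
      ∫ x, unitKernel p x ∂ν = c + ∑ r ∈ R, d r * (p + r)⁻¹ := fun p hp => by
    have hi : ∀ (a : ℝ) (x : I),
        Integrable (unitKernel p) (ENNReal.ofReal a • Measure.dirac x) := fun a x =>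
      (integrable_unitKernel hp _).smul_measure ENNReal.ofReal_ne_top
    rw [hν, integral_add_measure (hi _ _) (integrable_finsetSum_measure.2 fun r _ => hi _ _),
      integral_finsetSum_measure fun r _ => hi _ _, integral_smul_measure, integral_dirac,
      unitKernel_one_right, ENNReal.toReal_ofReal hc, smul_eq_mul, mul_one]
    congr 1
    refine Finset.sum_congr rfl fun r hr => ?_
    obtain ⟨hr0, hd⟩ := hR r hr
    rw [integral_smul_measure, integral_dirac, unitKernel_toUnit p hr0,
      ENNReal.toReal_ofReal (by positivity), smul_eq_mul]
    field_simp
  have hprob : IsProbabilityMeasure ν := by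
    have h := hint 1 one_pos
    rw [← hK 1 one_pos, h1] at h
    simp only [unitKernel_one_left, integral_const, smul_eq_mul, mul_one, div_one] at h
    exact ⟨by rw [← ofReal_measureReal (measure_ne_top ν _), h, ENNReal.ofReal_one]⟩
  refine ⟨⟨ν, hprob⟩, fun p hp => ?_⟩
  have hKp : 0 < ∑ j ∈ s, w j * (p + t j)⁻¹ := Finset.sum_pos (fun i hi =>
    mul_pos (Finset.mem_filter.1 hi).2 (inv_pos.2 (add_pos hp (hpos i hi)))) hne
  rw [ProbabilityMeasure.coe_mk, hint p hp, ← hK p hp, hsum p hp]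
  exact mul_one_div_cancel (mul_pos hp hKp).ne'

/-- Every probability measure on `[0, 1]` has a dual one with respect to the Stieltjes kernel. -/
theorem exists_dual (μ : Measure I) [IsProbabilityMeasure μ] :
    ∃ ν : ProbabilityMeasure I, ∀ p : ℝ, 0 < p →
      p * (∫ x, unitKernel p x ∂μ) * ∫ x, unitKernel p x ∂(ν : Measure I) = 1 := by
  choose ν hν using exists_dual_gridPoint μ
  -- Probability measures on the compact space `I` form a compact space. A limit along one
  -- ultrafilter replaces a subsequence and serves all `p` simultaneously.
  obtain ⟨ν', -, hlim⟩ := isCompact_univ.ultrafilter_le_nhds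
    (Ultrafilter.map ν (hyperfilter ℕ)) (by simp)
  refine ⟨ν', fun p hp => ?_⟩
  have hlim' : Tendsto ν (hyperfilter ℕ : Filter ℕ) (𝓝 ν') := hlim
  have hcont := continuous_unitKernel hp
  have h2 := ProbabilityMeasure.tendsto_iff_forall_integral_tendsto.1 hlim'
    (BoundedContinuousFunction.mkOfCompact ⟨unitKernel p, hcont⟩)
  have h1 : Tendsto (fun n => ∫ x, unitKernel p (gridPoint n x) ∂μ) atTop
      (𝓝 (∫ x, unitKernel p x ∂μ)) := by
    obtain ⟨C, hC⟩ := (isCompact_range hcont).isBounded.exists_norm_le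
    refine tendsto_integral_of_dominated_convergence (fun _ => C)
      (fun n => (hcont.measurable.comp (measurable_gridPoint n)).aestronglyMeasurable)
      (integrable_const _) (fun n => ae_of_all _ fun x => hC _ (mem_range_self _))
      (ae_of_all _ fun x => (hcont.tendsto x).comp (tendsto_gridPoint x))
  have h1' := h1.mono_left (Nat.hyperfilter_le_atTop)
  have h3 := (h1'.const_mul p).mul h2
  refine tendsto_nhds_unique h3 ?_
  refine tendsto_const_nhds.congr fun n => ?_
  exact (hν n p hp).symm

end Duality

/-! ### Return to Stieltjes functions on the half-line -/

section StieltjesDual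

open unitInterval

/-- If `K(p) = ∫ η(ds) / (p + s)` is nonzero, then `1 / (p K(p))` is a Stieltjes function. -/
theorem exists_stieltjes_dual {η : Measure ℝ}
    (hη : IntegrableOn (fun s : ℝ => (1 + s)⁻¹) (Ici 0) η)
    (hpos : 0 < ∫ s in Ici (0 : ℝ), (1 + s)⁻¹ ∂η) :
    ∃ (b : ℝ) (η' : Measure ℝ), 0 ≤ b ∧ IntegrableOn (fun s : ℝ => (1 + s)⁻¹) (Ici 0) η' ∧
      ∀ p : ℝ, 0 < p → 1 / (p * ∫ s in Ici (0 : ℝ), (p + s)⁻¹ ∂η) =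
        b + ∫ s in Ici (0 : ℝ), (p + s)⁻¹ ∂η' := by
  set m := ∫ s in Ici (0 : ℝ), (1 + s)⁻¹ ∂η with hm
  -- Dividing by `m`, the value of the transform at `p = 1`, makes `(1+s)⁻¹ η(ds)` a probability
  -- measure.
  set ρ : Measure ℝ := (η.restrict (Ici 0)).withDensity
    fun s => ENNReal.ofReal (m⁻¹ * (1 + s)⁻¹) with hρ
  have hnonneg : ∀ᵐ s ∂(η.restrict (Ici 0)), 0 ≤ m⁻¹ * (1 + s)⁻¹ :=
    (ae_restrict_iff' measurableSet_Ici).2 (ae_of_all _ fun s (hs : 0 ≤ s) => by positivity)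
  have hprob : IsProbabilityMeasure ρ := ⟨by
    rw [hρ, withDensity_apply _ MeasurableSet.univ, Measure.restrict_univ,
      ← ofReal_integral_eq_lintegral_ofReal (hη.const_mul _) hnonneg, integral_const_mul,
      inv_mul_cancel₀ hpos.ne', ENNReal.ofReal_one]⟩
  set μ : Measure I := ρ.map toUnit with hμ
  have hμprob : IsProbabilityMeasure μ :=
    Measure.isProbabilityMeasure_map measurable_toUnit.aemeasurable
  have hμint : ∀ p : ℝ, 0 < p → ∫ x, unitKernel p x ∂μ =
      m⁻¹ * ∫ s in Ici (0 : ℝ), (p + s)⁻¹ ∂η := fun p hp => by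
    rw [hμ, integral_map measurable_toUnit.aemeasurable
      (continuous_unitKernel hp).aestronglyMeasurable, hρ,
      integral_withDensity_eq_integral_toReal_smul (by fun_prop)
        (ae_of_all _ fun _ => ENNReal.ofReal_lt_top), ← integral_const_mul]
    refine setIntegral_congr_fun measurableSet_Ici fun s (hs : 0 ≤ s) => ?_
    rw [ENNReal.toReal_ofReal (by positivity), unitKernel_toUnit p hs, smul_eq_mul]
    field_simp
  obtain ⟨ν, hν⟩ := exists_dual μ
  -- Away from `x = 1` the compactification is undone by `s = x/(1-x)`: the kernel equals
  -- `(1-x)⁻¹/(p+s)`, which explains the density.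
  set κ : Measure I := ((ν : Measure I).restrict {1}ᶜ).withDensity
    fun x => ENNReal.ofReal (m⁻¹ * (1 - (x : ℝ))⁻¹) with hκ
  have hψ : Measurable fun x : I => (x : ℝ) / (1 - x) := by fun_prop
  have hψpre : (fun x : I => (x : ℝ) / (1 - x)) ⁻¹' Ici 0 = univ := by
    refine eq_univ_of_forall fun x => ?_
    exact div_nonneg x.2.1 (sub_nonneg.2 x.2.2)
  have hdens : ∀ p : ℝ, 0 < p → ∀ x ∈ ({1}ᶜ : Set I),
      (ENNReal.ofReal (m⁻¹ * (1 - (x : ℝ))⁻¹)).toReal • (p + (x : ℝ) / (1 - x))⁻¹ =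
        m⁻¹ * unitKernel p x := fun p hp x hx => by
    have hx1 : (x : ℝ) < 1 := lt_of_le_of_ne x.2.2 fun h => hx (Subtype.ext h)
    have hsub : 0 < 1 - (x : ℝ) := sub_pos.2 hx1
    have hk := unitKernel_denom_pos hp x
    rw [ENNReal.toReal_ofReal (by positivity), smul_eq_mul, unitKernel]
    have : p + (x : ℝ) / (1 - x) = (p * (1 - x) + x) / (1 - x) := by field_simp
    rw [this]
    field_simp
  refine ⟨m⁻¹ * (ν : Measure I).real {1}, κ.map fun x : I => (x : ℝ) / (1 - x), by positivity,
    ?_, fun p hp => ?_⟩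
  · rw [IntegrableOn, Measure.restrict_map hψ measurableSet_Ici, hψpre, Measure.restrict_univ,
      integrable_map_measure (by fun_prop) hψ.aemeasurable, hκ,
      integrable_withDensity_iff_integrable_smul' (by fun_prop)
        (ae_of_all _ fun _ => ENNReal.ofReal_lt_top)]
    refine Integrable.congr (f := fun x => m⁻¹ * unitKernel 1 x)
      ((integrable_unitKernel one_pos _).const_mul _) ?_
    refine (ae_restrict_iff' (measurableSet_singleton _).compl).2 (ae_of_all _ fun x hx => ?_)
    exact (hdens 1 one_pos x hx).symm
  · have hsplit : ∫ x, unitKernel p x ∂(ν : Measure I) =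
        (ν : Measure I).real {1} + ∫ x in {1}ᶜ, unitKernel p x ∂(ν : Measure I) := by
      rw [← integral_add_compl (measurableSet_singleton (1 : I)) (integrable_unitKernel hp _),
        integral_singleton, unitKernel_one_right, smul_eq_mul, mul_one]
    have hmap : ∫ s in Ici (0 : ℝ), (p + s)⁻¹ ∂(κ.map fun x : I => (x : ℝ) / (1 - x)) =
        m⁻¹ * ∫ x in {1}ᶜ, unitKernel p x ∂(ν : Measure I) := by
      rw [setIntegral_map measurableSet_Ici
        (by fun_prop : Measurable fun s : ℝ => (p + s)⁻¹).aestronglyMeasurable hψ.aemeasurable, hψpre,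
        Measure.restrict_univ, hκ, integral_withDensity_eq_integral_toReal_smul (by fun_prop)
        (ae_of_all _ fun _ => ENNReal.ofReal_lt_top), ← integral_const_mul]
      exact setIntegral_congr_fun (measurableSet_singleton _).compl fun x hx => hdens p hp x hx
    rw [hmap, ← mul_add, ← hsplit]
    have h := hν p hp
    rw [hμint p hp] at h
    have hK : ∫ s in Ici (0 : ℝ), (p + s)⁻¹ ∂η ≠ 0 := fun h0 => by
      rw [h0] at h; simp at h
    have hm0 := hpos.ne'
    generalize ∫ s in Ici (0 : ℝ), (p + s)⁻¹ ∂η = A at h hK ⊢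
    generalize ∫ x, unitKernel p x ∂(ν : Measure I) = B at h ⊢
    field_simp
    field_simp at h
    linarith

end StieltjesDual

/-! ### Exponential integrals of measures and their Laplace transforms -/

section LaplaceOfMeasure

variable {η : Measure ℝ}

/-- Fubini needs this. The measure with density `(1+s)⁻¹` is finite, and inverting this positive
density recovers `η` on `[0,∞)`. -/
lemma sFinite_restrict_of_integrableOn (hη : IntegrableOn (fun s : ℝ => (1 + s)⁻¹) (Ici 0) η) :
    SFinite (η.restrict (Ici 0)) := by
  set f : ℝ → ENNReal := fun s => ENNReal.ofReal (1 + s)⁻¹ with hf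
  have hmeas : Measurable f := by fun_prop
  have hfin : IsFiniteMeasure ((η.restrict (Ici 0)).withDensity f) :=
    isFiniteMeasure_withDensity_ofReal hη.2
  have hpos : ∀ᵐ s ∂(η.restrict (Ici 0)), f s ≠ 0 :=
    (ae_restrict_iff' measurableSet_Ici).2 (ae_of_all _ fun s (hs : 0 ≤ s) =>
      (ENNReal.ofReal_pos.2 (by positivity)).ne')
  rw [← withDensity_inv_same hmeas hpos (ae_of_all _ fun _ => ENNReal.ofReal_ne_top)]
  infer_instance

lemma integrableOn_inv_add (hη : IntegrableOn (fun s : ℝ => (1 + s)⁻¹) (Ici 0) η) {p : ℝ}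
    (hp : 0 < p) : IntegrableOn (fun s : ℝ => (p + s)⁻¹) (Ici 0) η := by
  refine Integrable.mono' (hη.const_mul (1 + 1 / p)) (by fun_prop) ?_
  refine (ae_restrict_iff' measurableSet_Ici).2 (ae_of_all _ fun s (hs : 0 ≤ s) => ?_)
  have h1 : 0 < 1 + s := by positivity
  have h2 : 0 < p + s := by positivity
  rw [Real.norm_of_nonneg (by positivity), inv_le_iff_one_le_mul₀ h2]
  have : (1 + 1 / p) * (1 + s)⁻¹ * (p + s) = 1 + (p + s / p) / (1 + s) := by
    field_simp; ring
  rw [this]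
  have : 0 ≤ (p + s / p) / (1 + s) := by positivity
  linarith

/-- From `1 + ts ≤ e^{ts}` one gets `e^{-ts} ≤ (1 + 1/t)/(1+s)`. -/
lemma integrableOn_exp (hη : IntegrableOn (fun s : ℝ => (1 + s)⁻¹) (Ici 0) η) {t : ℝ}
    (ht : 0 < t) : IntegrableOn (fun s : ℝ => Real.exp (-t * s)) (Ici 0) η := by
  refine Integrable.mono' (hη.const_mul (1 + 1 / t)) (by fun_prop) ?_
  refine (ae_restrict_iff' measurableSet_Ici).2 (ae_of_all _ fun s (hs : 0 ≤ s) => ?_)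
  have h1 : 0 < 1 + s := by positivity
  have h2 := Real.add_one_le_exp (t * s)
  rw [Real.norm_of_nonneg (by positivity), neg_mul, Real.exp_neg,
    inv_le_iff_one_le_mul₀ (Real.exp_pos _)]
  have h3 : (1 + 1 / t) * (1 + s)⁻¹ * (t * s + 1) = 1 + (t * s + 1 / t) / (1 + s) := by
    field_simp; ring
  have h4 : 0 ≤ (t * s + 1 / t) / (1 + s) := by positivity
  calc (1 : ℝ) ≤ (1 + 1 / t) * (1 + s)⁻¹ * (t * s + 1) := by rw [h3]; linarith
    _ ≤ _ := by gcongr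

/-- The function `t ↦ ∫ e^{-ts} η(ds)` on the half-line. -/
noncomputable def expIntegral (η : Measure ℝ) (t : ℝ) : ℝ :=
  ∫ s in Ici (0 : ℝ), Real.exp (-t * s) ∂η

lemma expIntegral_nonneg (t : ℝ) : 0 ≤ expIntegral η t :=
  integral_nonneg fun _ => (Real.exp_pos _).le

lemma antitoneOn_expIntegral (hη : IntegrableOn (fun s : ℝ => (1 + s)⁻¹) (Ici 0) η) :
    AntitoneOn (expIntegral η) (Ioi 0) := by
  intro x hx y hy hxy
  refine setIntegral_mono_on (integrableOn_exp hη hy) (integrableOn_exp hη hx) measurableSet_Ici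
    fun s (hs : 0 ≤ s) => ?_
  exact Real.exp_le_exp.2 (by nlinarith)

/-- Gives access to analyticity and the derivative formula of moment generating functions, which
yield complete monotonicity. -/
lemma expIntegral_eq_mgf :
    expIntegral η = ProbabilityTheory.mgf (fun s => -s) (η.restrict (Ici 0)) := by
  ext t
  simp only [expIntegral, ProbabilityTheory.mgf, neg_mul, mul_neg]

lemma mem_interior_integrableExpSet (hη : IntegrableOn (fun s : ℝ => (1 + s)⁻¹) (Ici 0) η)
    {t : ℝ} (ht : 0 < t) :
    t ∈ interior (ProbabilityTheory.integrableExpSet (fun s => -s) (η.restrict (Ici 0))) := by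
  refine interior_mono (s := Ioi 0) (fun x hx => ?_) (by simpa using ht)
  simpa [ProbabilityTheory.integrableExpSet, IntegrableOn] using integrableOn_exp hη hx

theorem completelyMonotone_expIntegral
    (hη : IntegrableOn (fun s : ℝ => (1 + s)⁻¹) (Ici 0) η) :
    CompletelyMonotone (expIntegral η) := by
  rw [expIntegral_eq_mgf]
  refine ⟨fun t ht => ?_, fun n t ht => ?_⟩
  · exact (ProbabilityTheory.analyticAt_mgf
      (mem_interior_integrableExpSet hη ht)).contDiffAt.contDiffWithinAt
  · rw [ProbabilityTheory.iteratedDeriv_mgf (mem_interior_integrableExpSet hη ht),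
      ← integral_const_mul]
    refine setIntegral_nonneg measurableSet_Ici fun s (hs : 0 ≤ s) => ?_
    rw [← mul_assoc, ← mul_pow, neg_one_mul, neg_neg]
    positivity

lemma continuousOn_expIntegral (hη : IntegrableOn (fun s : ℝ => (1 + s)⁻¹) (Ici 0) η) :
    ContinuousOn (expIntegral η) (Ioi 0) :=
  (completelyMonotone_expIntegral hη).1.continuousOn

lemma integral_exp_neg_mul_Ioi {a : ℝ} (ha : 0 < a) :
    ∫ t in Ioi (0 : ℝ), Real.exp (-a * t) = a⁻¹ := by
  rw [integral_exp_mul_Ioi (by linarith) 0]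
  simp [neg_div_neg_eq]

lemma laplace_expIntegral (hη : IntegrableOn (fun s : ℝ => (1 + s)⁻¹) (Ici 0) η) {p : ℝ}
    (hp : 0 < p) :
    IntegrableOn (fun t : ℝ => Real.exp (-p * t) * expIntegral η t) (Ioi 0) ∧
      laplace (expIntegral η) p = ∫ s in Ici (0 : ℝ), (p + s)⁻¹ ∂η := by
  have := sFinite_restrict_of_integrableOn hη
  set F : ℝ × ℝ → ℝ := fun z => Real.exp (-(p + z.2) * z.1) with hF
  have hslice : ∀ s : ℝ, 0 ≤ s → ∫ t in Ioi (0 : ℝ), F (t, s) = (p + s)⁻¹ := fun s hs =>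
    integral_exp_neg_mul_Ioi (a := p + s) (by positivity)
  -- Tonelli with `t` integrated first: the inner integral is `(p+s)⁻¹`, integrable against `η`.
  have hint : Integrable F ((volume.restrict (Ioi 0)).prod (η.restrict (Ici 0))) := by
    refine (integrable_prod_iff' (by fun_prop)).2 ⟨?_, ?_⟩
    · refine (ae_restrict_iff' measurableSet_Ici).2 (ae_of_all _ fun s (hs : 0 ≤ s) => ?_)
      exact integrableOn_exp_mul_Ioi (a := -(p + s)) (by linarith) 0
    · refine (integrableOn_inv_add hη hp).congr ?_
      refine (ae_restrict_iff' measurableSet_Ici).2 (ae_of_all _ fun s (hs : 0 ≤ s) => ?_)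
      simp only [hF, Real.norm_eq_abs, Real.abs_exp]
      exact (hslice s hs).symm
  have hin : ∀ t : ℝ, ∫ s in Ici (0 : ℝ), F (t, s) ∂η =
      Real.exp (-p * t) * expIntegral η t := fun t => by
    rw [expIntegral, ← integral_const_mul]
    refine integral_congr_ae (ae_of_all _ fun s => ?_)
    simp only [hF]
    rw [← Real.exp_add]
    ring_nf
  refine ⟨?_, ?_⟩
  · have h := hint.integral_prod_left
    simp only [hin] at h
    exact h
  · rw [laplace]
    simp_rw [← hin]
    rw [integral_integral_swap hint]
    exact setIntegral_congr_fun measurableSet_Ici fun s (hs : 0 ≤ s) => hslice s hs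

end LaplaceOfMeasure

/-! ### Uniqueness of the Laplace transform -/

section LaplaceUniqueness

open ProbabilityTheory

/-- The finite measure `e^{-t} f(t) dt` on the half-line. -/
noncomputable def tiltedMeasure (f : ℝ → ℝ) : Measure ℝ :=
  (volume.restrict (Ioi 0)).withDensity fun t => ENNReal.ofReal (Real.exp (-1 * t) * f t)

variable {f g : ℝ → ℝ}

lemma aemeasurable_tilt (hf : HasLaplace f) :
    AEMeasurable (fun t => ENNReal.ofReal (Real.exp (-1 * t) * f t))
      (volume.restrict (Ioi 0)) :=
  (hf 1 one_pos).1.aemeasurable.ennreal_ofReal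

lemma isFiniteMeasure_tiltedMeasure (hf : HasLaplace f) : IsFiniteMeasure (tiltedMeasure f) :=
  isFiniteMeasure_withDensity_ofReal (hf 1 one_pos).2

lemma toReal_tilt_smul (hf0 : ∀ t, 0 < t → 0 ≤ f t) (x : ℝ) :
    (fun t => (ENNReal.ofReal (Real.exp (-1 * t) * f t)).toReal • Real.exp (x * t))
      =ᵐ[volume.restrict (Ioi 0)] fun t => Real.exp (-(1 - x) * t) * f t := by
  refine (ae_restrict_iff' measurableSet_Ioi).2 (ae_of_all _ fun t (ht : 0 < t) => ?_)
  have := hf0 t ht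
  simp only
  rw [ENNReal.toReal_ofReal (by positivity), smul_eq_mul, mul_right_comm, ← Real.exp_add]
  ring_nf

lemma mgf_tiltedMeasure (hf : HasLaplace f) (hf0 : ∀ t, 0 < t → 0 ≤ f t) (x : ℝ) :
    mgf id (tiltedMeasure f) x = laplace f (1 - x) := by
  rw [mgf, tiltedMeasure, integral_withDensity_eq_integral_toReal_smul₀ (aemeasurable_tilt hf)
    (ae_of_all _ fun _ => ENNReal.ofReal_lt_top), laplace]
  exact integral_congr_ae (toReal_tilt_smul hf0 x)

lemma Iio_subset_integrableExpSet (hf : HasLaplace f) (hf0 : ∀ t, 0 < t → 0 ≤ f t) :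
    Iio 1 ⊆ interior (integrableExpSet id (tiltedMeasure f)) := by
  refine interior_maximal (fun x (hx : x < 1) => ?_) isOpen_Iio
  rw [integrableExpSet, mem_ofPred_eq, tiltedMeasure,
    integrable_withDensity_iff_integrable_smul₀' (aemeasurable_tilt hf)
    (ae_of_all _ fun _ => ENNReal.ofReal_lt_top)]
  exact (hf (1 - x) (by linarith)).congr (toReal_tilt_smul hf0 x).symm

/-- A nonnegative function on the half-line is determined by its Laplace transform. -/
theorem ae_eq_of_laplace_eq (hf : HasLaplace f) (hg : HasLaplace g)
    (hf0 : ∀ t, 0 < t → 0 ≤ f t) (hg0 : ∀ t, 0 < t → 0 ≤ g t)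
    (h : ∀ p, 0 < p → laplace f p = laplace g p) :
    f =ᵐ[volume.restrict (Ioi 0)] g := by
  have := isFiniteMeasure_tiltedMeasure hf
  have := isFiniteMeasure_tiltedMeasure hg
  -- Both transforms are analytic for `Re z < 1` and agree at real points near `0`, so they agree on
  -- the half-plane. The imaginary axis lies inside it and carries the characteristic functions.
  have hE : EqOn (complexMGF id (tiltedMeasure f)) (complexMGF id (tiltedMeasure g))
      {z | z.re < 1} := by
    refine AnalyticOnNhd.eqOn_of_preconnected_of_frequently_eq (z₀ := ((0 : ℝ) : ℂ))
      (analyticOnNhd_complexMGF.mono fun z hz => Iio_subset_integrableExpSet hf hf0 hz)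
      (analyticOnNhd_complexMGF.mono fun z hz => Iio_subset_integrableExpSet hg hg0 hz)
      (convex_halfSpace_re_lt 1).isPreconnected (by simp) ?_
    have h_real : ∃ᶠ x : ℝ in 𝓝[≠] 0,
        complexMGF id (tiltedMeasure f) x = complexMGF id (tiltedMeasure g) x := by
      refine Eventually.frequently ?_
      filter_upwards [mem_nhdsWithin_of_mem_nhds (Iio_mem_nhds one_pos)] with x hx
      rw [complexMGF_ofReal, complexMGF_ofReal, mgf_tiltedMeasure hf hf0,
        mgf_tiltedMeasure hg hg0, h _ (sub_pos.2 hx)]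
    have ht : Tendsto (fun x : ℝ => (x : ℂ)) (𝓝[≠] 0) (𝓝[≠] ((0 : ℝ) : ℂ)) := by
      refine tendsto_nhdsWithin_iff.2
        ⟨(Complex.continuous_ofReal.tendsto 0).mono_left nhdsWithin_le_nhds, ?_⟩
      filter_upwards [self_mem_nhdsWithin] with x hx
      simpa using hx
    exact ht.frequently h_real
  have hmeas : tiltedMeasure f = tiltedMeasure g := by
    refine Measure.ext_of_charFun (funext fun t => ?_)
    rw [← complexMGF_id_mul_I, ← complexMGF_id_mul_I]
    exact hE (by simp)
  have hd := (withDensity_eq_iff (aemeasurable_tilt hf) (aemeasurable_tilt hg)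
    (hf 1 one_pos).lintegral_lt_top.ne).1 hmeas
  filter_upwards [hd, ae_restrict_mem measurableSet_Ioi] with t ht ht0
  have hf' := hf0 t ht0
  have hg' := hg0 t ht0
  rw [ENNReal.ofReal_eq_ofReal_iff (by positivity) (by positivity)] at ht
  exact mul_left_cancel₀ (Real.exp_pos _).ne' ht

end LaplaceUniqueness

/-! ### Convolution on the half-line -/

section Convolution

variable {a b f : ℝ → ℝ} {t : ℝ}

/-- Extension by zero turns the convolution into an integral over the whole line, where translation
invariance and Fubini apply directly. -/
lemma indicator_Ioo_conv_integrand (a b : ℝ → ℝ) (t : ℝ) :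
    (fun s => (Ioi 0).indicator a (t - s) * (Ioi 0).indicator b s) =
      (Ioo 0 t).indicator fun s => a (t - s) * b s := by
  ext s
  by_cases h1 : 0 < s
  · by_cases h2 : s < t
    · rw [indicator_of_mem (show t - s ∈ Ioi 0 from sub_pos.2 h2), indicator_of_mem (mem_Ioi.2 h1),
        indicator_of_mem (show s ∈ Ioo 0 t from ⟨h1, h2⟩)]
    · rw [indicator_of_notMem (s := Ioi 0) (show t - s ∉ Ioi 0 from fun h => h2 (sub_pos.1 h)),
        indicator_of_notMem (s := Ioo 0 t) (fun h => h2 h.2), zero_mul]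
  · rw [indicator_of_notMem (s := Ioi 0) (a := s) h1,
      indicator_of_notMem (s := Ioo 0 t) (fun h => h1 h.1),
      mul_zero]

lemma conv_eq_integral (a b : ℝ → ℝ) (ht : 0 ≤ t) :
    conv a b t = ∫ s, (Ioi 0).indicator a (t - s) * (Ioi 0).indicator b s := by
  rw [indicator_Ioo_conv_integrand, integral_indicator measurableSet_Ioo, conv,
    intervalIntegral.integral_of_le ht, integral_Ioc_eq_integral_Ioo]

lemma intervalIntegrable_conv_iff (a b : ℝ → ℝ) (ht : 0 ≤ t) :
    IntervalIntegrable (fun s => a (t - s) * b s) volume 0 t ↔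
      Integrable fun s => (Ioi 0).indicator a (t - s) * (Ioi 0).indicator b s := by
  rw [indicator_Ioo_conv_integrand, integrable_indicator_iff measurableSet_Ioo,
    intervalIntegrable_iff_integrableOn_Ioo_of_le ht]

lemma conv_zero (a b : ℝ → ℝ) : conv a b 0 = 0 := intervalIntegral.integral_same

lemma conv_comm (a b : ℝ → ℝ) (t : ℝ) : conv a b t = conv b a t := by
  have := intervalIntegral.integral_comp_sub_left (a := 0) (b := t)
    (fun s => b (t - s) * a s) t
  simp only [sub_self, sub_zero, sub_sub_cancel] at this
  rw [conv, conv, ← this]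
  simp only [mul_comm]

lemma intervalIntegrable_conv_comm
    (h : IntervalIntegrable (fun s => a (t - s) * b s) volume 0 t) :
    IntervalIntegrable (fun s => b (t - s) * a s) volume 0 t := by
  have := (h.comp_sub_left t).symm
  simpa only [sub_self, sub_zero, sub_sub_cancel, mul_comm] using this

lemma conv_nonneg (ha : ∀ s, 0 < s → 0 ≤ a s) (hb : ∀ s, 0 < s → 0 ≤ b s) (ht : 0 ≤ t) :
    0 ≤ conv a b t := by
  rw [conv_eq_integral a b ht]
  exact integral_nonneg fun s =>
    mul_nonneg (indicator_nonneg (fun x hx => ha x hx) _) (indicator_nonneg (fun x hx => hb x hx) _)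

lemma conv_congr_ae {a' b' : ℝ → ℝ} (ha : a =ᵐ[volume.restrict (Ioi 0)] a')
    (hb : b =ᵐ[volume.restrict (Ioi 0)] b') (ht : 0 ≤ t) : conv a b t = conv a' b' t := by
  rw [conv_eq_integral a b ht, conv_eq_integral a' b' ht]
  have ha' := (ae_eq_restrict_iff_indicator_ae_eq measurableSet_Ioi).1 ha
  have hb' := (ae_eq_restrict_iff_indicator_ae_eq measurableSet_Ioi).1 hb
  have ha'' := (quasiMeasurePreserving_sub_left volume t).ae_eq ha'
  refine integral_congr_ae ?_
  filter_upwards [ha'', hb'] with s h1 h2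
  simp only [Function.comp_apply] at h1
  rw [h1, h2]

/-- The integral of a non-integrable function is `0` by convention, so a nonzero value certifies
integrability. -/
lemma intervalIntegrable_of_conv_ne_zero (h : conv a b t ≠ 0) :
    IntervalIntegrable (fun s => a (t - s) * b s) volume 0 t := by
  by_contra hn
  exact h (intervalIntegral.integral_undef hn)

/-- Associativity of the convolution of two nonnegative functions with locally bounded convolution
and an integrable function. -/
theorem conv_assoc {C : ℝ} (ht : 0 < t)
    (ham : AEStronglyMeasurable a (volume.restrict (Ioi 0)))
    (hbm : AEStronglyMeasurable b (volume.restrict (Ioi 0)))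
    (ha : ∀ s, 0 < s → 0 ≤ a s) (hb : ∀ s, 0 < s → 0 ≤ b s)
    (hab : ∀ τ, 0 < τ → τ ≤ t →
      IntervalIntegrable (fun s => a (τ - s) * b s) volume 0 τ ∧ conv a b τ ≤ C)
    (hf : IntervalIntegrable f volume 0 t) :
    IntervalIntegrable (fun s => a (t - s) * conv b f s) volume 0 t ∧
      conv a (conv b f) t = conv (conv a b) f t := by
  set A := (Ioi (0 : ℝ)).indicator a with hA
  set B := (Ioi (0 : ℝ)).indicator b with hB
  set Φ := (Ioo 0 t).indicator f with hΦ
  have hAm : AEStronglyMeasurable A volume :=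
    (aestronglyMeasurable_indicator_iff measurableSet_Ioi).2 ham
  have hBm : AEStronglyMeasurable B volume :=
    (aestronglyMeasurable_indicator_iff measurableSet_Ioi).2 hbm
  have hΦi : Integrable Φ volume := (integrable_indicator_iff measurableSet_Ioo).2
    ((intervalIntegrable_iff_integrableOn_Ioo_of_le ht.le).1 hf)
  have hA0 : ∀ s, 0 ≤ A s := fun s => indicator_nonneg (fun x hx => ha x hx) _
  have hB0 : ∀ s, 0 ≤ B s := fun s => indicator_nonneg (fun x hx => hb x hx) _
  set F : ℝ × ℝ → ℝ := fun z => A (t - z.1) * (B (z.1 - z.2) * Φ z.2) with hF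
  have hFm : AEStronglyMeasurable F (volume.prod volume) := by
    refine AEStronglyMeasurable.mul ?_ (AEStronglyMeasurable.mul ?_ ?_)
    · exact (hAm.comp_quasiMeasurePreserving (quasiMeasurePreserving_sub_left volume t)).comp_fst
    · exact hBm.comp_quasiMeasurePreserving
        (quasiMeasurePreserving_sub_of_right_invariant volume volume)
    · exact hΦi.1.comp_snd
  have hΦ0 : ∀ r, ¬ (0 < r ∧ r < t) → Φ r = 0 := fun r hr =>
    indicator_of_notMem (s := Ioo 0 t) hr _
  -- the inner integral in the first variable
  have hshift : ∀ r s, A (t - s) * B (s - r) =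
      (fun s' => A ((t - r) - s') * B s') (s - r) := fun r s => by
    simp only
    rw [show t - r - (s - r) = t - s by ring]
  have hin1 : ∀ r, 0 < r → r < t → Integrable (fun s => A (t - s) * B (s - r)) ∧
      ∫ s, A (t - s) * B (s - r) = conv a b (t - r) := fun r h1 h2 => by
    have h := (intervalIntegrable_conv_iff a b (sub_pos.2 h2).le).1
      (hab (t - r) (sub_pos.2 h2) (by linarith)).1
    simp only [hshift r]
    refine ⟨h.comp_sub_right r, ?_⟩
    rw [integral_sub_right_eq_self (fun s' => A ((t - r) - s') * B s') r,
      conv_eq_integral a b (sub_pos.2 h2).le]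
  have hrw : ∀ s r, F (s, r) = Φ r * (A (t - s) * B (s - r)) := fun s r => by
    simp only [hF]; ring
  have hnorm : ∀ s r, ‖F (s, r)‖ = ‖Φ r‖ * (A (t - s) * B (s - r)) := fun s r => by
    rw [hrw, norm_mul, Real.norm_of_nonneg (mul_nonneg (hA0 _) (hB0 _))]
  -- Integrating the absolute value in `s` first leaves `|Φ(r)| (a*b)(t-r) ≤ C |Φ(r)|`.
  have hFi : Integrable F (volume.prod volume) := by
    refine (integrable_prod_iff' hFm).2 ⟨ae_of_all _ fun r => ?_, ?_⟩
    · simp only [hrw]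
      by_cases hr : 0 < r ∧ r < t
      · exact (hin1 r hr.1 hr.2).1.const_mul _
      · simp only [hΦ0 r hr, zero_mul]
        exact integrable_zero _ _ _
    · refine Integrable.mono' (hΦi.norm.const_mul C)
        hFm.norm.prod_swap.integral_prod_right' (ae_of_all _ fun r => ?_)
      rw [Real.norm_of_nonneg (integral_nonneg fun s => norm_nonneg _)]
      simp only [hnorm]
      rw [integral_const_mul, mul_comm C]
      by_cases hr : 0 < r ∧ r < t
      · rw [(hin1 r hr.1 hr.2).2]
        exact mul_le_mul_of_nonneg_left
          (hab (t - r) (sub_pos.2 hr.2) (by linarith [hr.1])).2 (norm_nonneg _)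
      · rw [hΦ0 r hr]; simp
  -- the inner integral in the second variable
  have hin2 : ∀ s, ∫ r, F (s, r) = A (t - s) * (Ioi 0).indicator (conv b f) s := fun s => by
    simp only [hF]
    rw [integral_const_mul]
    by_cases hs : s < t
    · congr 1
      by_cases hs0 : 0 < s
      · rw [indicator_of_mem (mem_Ioi.2 hs0), conv_eq_integral b f hs0.le]
        refine integral_congr_ae (ae_of_all _ fun r => ?_)
        simp only
        by_cases hrs : r < s
        · congr 1
          by_cases hr : 0 < r
          · rw [hΦ, indicator_of_mem (show r ∈ Ioo 0 t from ⟨hr, hrs.trans hs⟩),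
              indicator_of_mem (mem_Ioi.2 hr)]
          · rw [hΦ0 r fun h => hr h.1, indicator_of_notMem (s := Ioi 0) hr]
        · rw [hB, indicator_of_notMem (s := Ioi 0) (fun h => hrs (sub_pos.1 h)), zero_mul, zero_mul]
      · rw [indicator_of_notMem (s := Ioi 0) hs0]
        refine integral_eq_zero_of_ae (ae_of_all _ fun r => ?_)
        simp only [Pi.zero_apply]
        by_cases hr : 0 < r
        · rw [hB, indicator_of_notMem (s := Ioi 0) (fun h => hs0 (hr.trans (sub_pos.1 h))),
            zero_mul]
        · rw [hΦ0 r fun h => hr h.1, mul_zero]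
    · rw [hA, indicator_of_notMem (s := Ioi 0) (fun h => hs (sub_pos.1 h)), zero_mul, zero_mul]
  have hin3 : ∀ r, ∫ s, F (s, r) =
      (Ioi 0).indicator (conv a b) (t - r) * (Ioi 0).indicator f r := fun r => by
    simp only [hrw]
    rw [integral_const_mul]
    by_cases hr : 0 < r ∧ r < t
    · rw [(hin1 r hr.1 hr.2).2, indicator_of_mem (mem_Ioi.2 (sub_pos.2 hr.2)),
        indicator_of_mem (mem_Ioi.2 hr.1), hΦ, indicator_of_mem (show r ∈ Ioo 0 t from hr),
        mul_comm]
    · rw [hΦ0 r hr, zero_mul]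
      have := congrFun (indicator_Ioo_conv_integrand (conv a b) f t) r
      rw [this, indicator_of_notMem (s := Ioo 0 t) hr]
  refine ⟨?_, ?_⟩
  · rw [intervalIntegrable_conv_iff a (conv b f) ht.le]
    have := hFi.integral_prod_left
    simpa only [hin2] using this
  · rw [conv_eq_integral a (conv b f) ht.le, conv_eq_integral (conv a b) f ht.le]
    have := integral_integral_swap (f := fun s r => F (s, r)) hFi
    simpa only [hin2, hin3] using this

lemma intervalIntegrable_mul_bdd {C : ℝ} (ha : IntervalIntegrable a volume 0 t) (ht : 0 ≤ t)
    (hfm : AEStronglyMeasurable f (volume.restrict (Ioi 0)))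
    (hfC : ∀ s ∈ Ioc 0 t, |f s| ≤ C) :
    IntervalIntegrable (fun s => a (t - s) * f s) volume 0 t := by
  have h1 := (ha.comp_sub_left t).symm
  rw [sub_self, sub_zero] at h1
  rw [intervalIntegrable_iff_integrableOn_Ioc_of_le ht] at h1 ⊢
  refine Integrable.mul_bdd (c := C) h1 (hfm.mono_set Ioc_subset_Ioi_self) ?_
  exact (ae_restrict_iff' measurableSet_Ioc).2 (ae_of_all _ fun s hs => hfC s hs)

/-- The increments of the convolution of a nonincreasing integrable function and a bounded
function are controlled by the primitive of the former. -/
lemma abs_conv_sub_le {C T t' : ℝ} (ha0 : ∀ s, 0 < s → 0 ≤ a s) (hanti : AntitoneOn a (Ioi 0))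
    (hai : ∀ T, 0 < T → IntervalIntegrable a volume 0 T)
    (hfm : AEStronglyMeasurable f (volume.restrict (Ioi 0)))
    (hfC : ∀ s ∈ Ioc 0 T, |f s| ≤ C) (ht : 0 ≤ t) (htt : t < t') (hT : t' ≤ T) :
    |conv a f t' - conv a f t| ≤ 2 * C * ∫ s in (0 : ℝ)..(t' - t), a s := by
  have ht'0 : 0 < t' := ht.trans_lt htt
  have hC : 0 ≤ C := (abs_nonneg _).trans (hfC t' ⟨ht'0, hT⟩)
  have hai' : ∀ T, 0 ≤ T → IntervalIntegrable a volume 0 T := fun T hT => by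
    rcases hT.eq_or_lt with rfl | h
    · exact IntervalIntegrable.refl
    · exact hai T h
  have hi' : IntervalIntegrable (fun s => a (t' - s) * f s) volume 0 t' :=
    intervalIntegrable_mul_bdd (hai t' ht'0) ht'0.le hfm
      fun s hs => hfC s ⟨hs.1, hs.2.trans hT⟩
  have hi : IntervalIntegrable (fun s => a (t - s) * f s) volume 0 t :=
    intervalIntegrable_mul_bdd (hai' t ht) ht hfm
      fun s hs => hfC s ⟨hs.1, hs.2.trans (htt.le.trans hT)⟩
  have hs' : IntervalIntegrable (fun s => a (t' - s)) volume 0 t' := by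
    simpa using ((hai t' ht'0).comp_sub_left t').symm
  have hs : IntervalIntegrable (fun s => a (t - s)) volume 0 t := by
    simpa using ((hai' t ht).comp_sub_left t).symm
  have hsub1 : uIcc 0 t ⊆ uIcc 0 t' := by
    rw [uIcc_of_le ht, uIcc_of_le ht'0.le]; exact Icc_subset_Icc_right htt.le
  have hsub2 : uIcc t t' ⊆ uIcc 0 t' := by
    rw [uIcc_of_le htt.le, uIcc_of_le ht'0.le]; exact Icc_subset_Icc_left ht
  -- With `h = t' - t`, the old range contributes at most `C (∫_0^h a - ∫_t^{t'} a)` because `a` is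
  -- nonincreasing, and the new range at most `C ∫_0^h a`.
  have hsplit : conv a f t' - conv a f t =
      (∫ s in (0 : ℝ)..t, (a (t' - s) * f s - a (t - s) * f s)) +
        ∫ s in t..t', a (t' - s) * f s := by
    rw [intervalIntegral.integral_sub (hi'.mono_set hsub1) hi, conv, conv,
      ← intervalIntegral.integral_add_adjacent_intervals (hi'.mono_set hsub1) (hi'.mono_set hsub2)]
    ring
  have hb1 : |∫ s in (0 : ℝ)..t, (a (t' - s) * f s - a (t - s) * f s)| ≤
      ∫ s in (0 : ℝ)..t, C * (a (t - s) - a (t' - s)) := by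
    rw [← Real.norm_eq_abs]
    refine intervalIntegral.norm_integral_le_of_norm_le ht ?_
      ((hs.sub (hs'.mono_set hsub1)).const_mul C)
    have hne : ∀ᵐ s : ℝ, s ≠ t := by simp [ae_iff, measure_singleton]
    filter_upwards [hne] with s hne hs
    have hlt : s < t := lt_of_le_of_ne hs.2 hne
    have hmono : a (t' - s) ≤ a (t - s) :=
      hanti (mem_Ioi.2 (sub_pos.2 hlt)) (mem_Ioi.2 (sub_pos.2 (hlt.trans htt))) (by linarith)
    rw [← sub_mul, Real.norm_eq_abs, abs_mul, abs_of_nonpos (sub_nonpos.2 hmono), mul_comm,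
      neg_sub]
    exact mul_le_mul_of_nonneg_right (hfC s ⟨hs.1, (hlt.trans htt).le.trans hT⟩)
      (sub_nonneg.2 hmono)
  have hb2 : |∫ s in t..t', a (t' - s) * f s| ≤ ∫ s in t..t', C * a (t' - s) := by
    rw [← Real.norm_eq_abs]
    refine intervalIntegral.norm_integral_le_of_norm_le htt.le ?_
      ((hs'.mono_set hsub2).const_mul C)
    have hne : ∀ᵐ s : ℝ, s ≠ t' := by simp [ae_iff, measure_singleton]
    filter_upwards [hne] with s hne hs
    have h0 : 0 ≤ a (t' - s) := ha0 _ (sub_pos.2 (lt_of_le_of_ne hs.2 hne))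
    rw [Real.norm_eq_abs, abs_mul, abs_of_nonneg h0, mul_comm]
    exact mul_le_mul_of_nonneg_right (hfC s ⟨ht.trans_lt hs.1, hs.2.trans hT⟩) h0
  rw [intervalIntegral.integral_const_mul, intervalIntegral.integral_sub hs (hs'.mono_set hsub1),
    intervalIntegral.integral_comp_sub_left, intervalIntegral.integral_comp_sub_left] at hb1
  rw [intervalIntegral.integral_const_mul, intervalIntegral.integral_comp_sub_left] at hb2
  simp only [sub_self, sub_zero] at hb1 hb2
  have hadd := intervalIntegral.integral_add_adjacent_intervals
    (hai' (t' - t) (sub_pos.2 htt).le)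
    ((hai' (t' - t) (sub_pos.2 htt).le).symm.trans (hai t' ht'0))
  have hadd2 := intervalIntegral.integral_add_adjacent_intervals (hai' t ht)
    ((hai' t ht).symm.trans (hai t' ht'0))
  have hpos : 0 ≤ ∫ s in t..t', a s :=
    intervalIntegral.integral_nonneg_of_ae_restrict htt.le
      ((ae_restrict_iff' measurableSet_Icc).2 (by
        have hne : ∀ᵐ s : ℝ, s ≠ 0 := by simp [ae_iff, measure_singleton]
        filter_upwards [hne] with s hne hs
        exact ha0 s (lt_of_le_of_ne (ht.trans hs.1) hne.symm)))
  rw [hsplit]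
  refine (abs_add_le _ _).trans ((add_le_add hb1 hb2).trans ?_)
  rw [← mul_add, mul_comm 2 C, mul_assoc]
  refine mul_le_mul_of_nonneg_left ?_ hC
  linarith

/-- The increment bound `2C ∫_0^h a` tends to `0` with `h`, as the primitive of `a` is continuous at
`0`. No continuity of `f` is needed. -/
theorem continuousOn_conv (ha0 : ∀ s, 0 < s → 0 ≤ a s) (hanti : AntitoneOn a (Ioi 0))
    (hai : ∀ T, 0 < T → IntervalIntegrable a volume 0 T) (hf : LocBddMeasurable f) :
    ContinuousOn (conv a f) (Ici 0) := by
  intro t₀ ht₀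
  have ht₀ : 0 ≤ t₀ := ht₀
  obtain ⟨C, hC⟩ := hf.2 (t₀ + 1) (by linarith)
  set G : ℝ → ℝ := fun h => ∫ s in (0 : ℝ)..h, a s with hG
  have hbound : ∀ t ∈ Ici (0 : ℝ) ∩ Iio (t₀ + 1),
      dist (conv a f t) (conv a f t₀) ≤ 2 * C * G |t - t₀| := by
    rintro t ⟨h0, h1⟩
    have h0 : 0 ≤ t := h0
    have h1 : t < t₀ + 1 := h1
    rw [Real.dist_eq]
    rcases lt_trichotomy t t₀ with h | rfl | h
    · rw [abs_sub_comm, abs_sub_comm t t₀, abs_of_pos (sub_pos.2 h)]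
      exact abs_conv_sub_le ha0 hanti hai hf.1 hC h0 h (by linarith)
    · simp [hG]
    · rw [abs_of_pos (sub_pos.2 h)]
      exact abs_conv_sub_le ha0 hanti hai hf.1 hC ht₀ h h1.le
  have hG0 : Tendsto (fun t => G |t - t₀|) (𝓝[Ici 0] t₀) (𝓝 0) := by
    have hc := intervalIntegral.continuousOn_primitive_interval' (hai 1 one_pos)
      (left_mem_uIcc) 0 left_mem_uIcc
    rw [uIcc_of_le zero_le_one] at hc
    have hc' : Tendsto G (𝓝[Icc 0 1] 0) (𝓝 0) := by
      have : G 0 = 0 := intervalIntegral.integral_same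
      simpa [ContinuousWithinAt, this, hG] using hc
    refine hc'.comp (tendsto_nhdsWithin_iff.2 ⟨?_, ?_⟩)
    · have : Continuous fun t : ℝ => |t - t₀| := by fun_prop
      have h := this.tendsto t₀
      simp only [sub_self, abs_zero] at h
      exact h.mono_left nhdsWithin_le_nhds
    · refine mem_nhdsWithin_of_mem_nhds ?_
      filter_upwards [Metric.ball_mem_nhds t₀ one_pos] with t ht
      rw [Metric.mem_ball, Real.dist_eq] at ht
      exact ⟨abs_nonneg _, ht.le⟩
  refine tendsto_iff_dist_tendsto_zero.2 (squeeze_zero' (g := fun t => 2 * C * G |t - t₀|)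
    (Eventually.of_forall fun _ => dist_nonneg) ?_ (by simpa using hG0.const_mul (2 * C)))
  exact mem_of_superset (inter_mem_nhdsWithin _ (Iio_mem_nhds (by linarith))) hbound

/-- If the convolution of two nonnegative, nonincreasing continuous functions is almost everywhere
equal to `1`, then it is everywhere equal to `1`. -/
theorem conv_eq_one_of_ae (ha0 : ∀ s, 0 < s → 0 ≤ a s) (hb0 : ∀ s, 0 < s → 0 ≤ b s)
    (ha : AntitoneOn a (Ioi 0)) (hb : AntitoneOn b (Ioi 0))
    (hac : ContinuousOn a (Ioi 0)) (hbc : ContinuousOn b (Ioi 0))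
    (h : conv a b =ᵐ[volume.restrict (Ioi 0)] fun _ => 1) :
    EqOn (conv a b) (fun _ => 1) (Ioi 0) := by
  refine Measure.eqOn_open_of_ae_eq h isOpen_Ioi ?_ continuousOn_const
  -- Scaling `s = t x` fixes the interval of integration and moves `t` into the arguments of `a` and
  -- `b`.
  set G : ℝ → ℝ := fun t => ∫ x in (0 : ℝ)..1, a (t * (1 - x)) * b (t * x) with hG
  have hscale : ∀ t, conv a b t = t * G t := fun t => by
    have := intervalIntegral.mul_integral_comp_mul_left (a := 0) (b := 1)
      (f := fun s => a (t - s) * b s) t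
    rw [mul_zero, mul_one] at this
    rw [conv, ← this, hG]
    simp only [mul_sub, mul_one]
  have hcont : ∀ t, 0 < t → ContinuousAt G t := by
    intro t₀ ht₀
    -- At some `t₁ < t₀` the convolution is `1`, so the scaled integrand there is integrable. By
    -- monotonicity it dominates the integrand for every `t > t₁`, hence near `t₀`.
    obtain ⟨t₁, ⟨h1pos, h1lt⟩, h1⟩ : ∃ t₁ ∈ Ioo 0 t₀, conv a b t₁ = 1 := by
      by_contra! hcon
      have h2 := ae_restrict_of_ae_restrict_of_subset
        (Ioo_subset_Ioi_self : Ioo 0 t₀ ⊆ Ioi 0) h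
      have h3 : ∀ᵐ t ∂(volume.restrict (Ioo 0 t₀)), False := by
        filter_upwards [h2, ae_restrict_mem measurableSet_Ioo] with t h4 h5
        exact hcon t h5 h4
      rw [eventually_false_iff_eq_bot, ae_eq_bot, Measure.restrict_eq_zero, Real.volume_Ioo,
        ENNReal.ofReal_eq_zero] at h3
      linarith
    have hint : IntervalIntegrable (fun x => a (t₁ * (1 - x)) * b (t₁ * x)) volume 0 1 := by
      by_contra hn
      have := intervalIntegral.integral_undef hn
      rw [hscale, hG] at h1
      simp only [this, mul_zero, zero_ne_one] at h1
    have hne : ∀ᵐ x : ℝ, x ≠ 1 := by simp [ae_iff, measure_singleton]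
    refine intervalIntegral.continuousAt_of_dominated_interval
      (bound := fun x => a (t₁ * (1 - x)) * b (t₁ * x)) ?_ ?_ hint ?_
    · filter_upwards [Ioi_mem_nhds ht₀] with t ht
      have ht : 0 < t := ht
      rw [uIoc_of_le zero_le_one, ← restrict_Ioo_eq_restrict_Ioc]
      refine ContinuousOn.aestronglyMeasurable (ContinuousOn.mul ?_ ?_) measurableSet_Ioo
      · exact hac.comp (by fun_prop) fun x hx => mul_pos ht (sub_pos.2 hx.2)
      · exact hbc.comp (by fun_prop) fun x hx => mul_pos ht hx.1
    · filter_upwards [Ioi_mem_nhds h1lt] with t ht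
      have ht : t₁ < t := ht
      filter_upwards [hne] with x hx1 hx
      rw [uIoc_of_le zero_le_one] at hx
      have hx2 : 0 < 1 - x := sub_pos.2 (lt_of_le_of_ne hx.2 hx1)
      have hx0 := hx.1
      have ht0 := h1pos.trans ht
      rw [Real.norm_of_nonneg (mul_nonneg (ha0 _ (by positivity)) (hb0 _ (by positivity)))]
      refine mul_le_mul (ha ?_ ?_ ?_) (hb ?_ ?_ ?_) (hb0 _ (by positivity)) (ha0 _ (by positivity))
      · exact mul_pos h1pos hx2
      · exact mul_pos ht0 hx2
      · gcongr
      · exact mul_pos h1pos hx0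
      · exact mul_pos ht0 hx0
      · gcongr
    · filter_upwards [hne] with x hx1 hx
      rw [uIoc_of_le zero_le_one] at hx
      have hx2 : 0 < 1 - x := sub_pos.2 (lt_of_le_of_ne hx.2 hx1)
      refine ContinuousAt.mul ?_ ?_
      · exact ContinuousAt.comp (f := fun t => t * (1 - x))
          (hac.continuousAt (Ioi_mem_nhds (mul_pos ht₀ hx2))) (by fun_prop)
      · exact ContinuousAt.comp (f := fun t => t * x)
          (hbc.continuousAt (Ioi_mem_nhds (mul_pos ht₀ hx.1))) (by fun_prop)
  intro t ht
  rw [funext hscale]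
  exact (continuousAt_id.mul (hcont t ht)).continuousWithinAt

end Convolution

/-! ### Lebesgue differentiation of primitives on the half-line -/

section Primitive

lemma ae_hasDerivAt_primitive {g : ℝ → ℝ} (hg : ∀ T, 0 < T → IntervalIntegrable g volume 0 T) :
    ∀ᵐ t ∂(volume.restrict (Ioi (0 : ℝ))),
      HasDerivAt (fun x => ∫ y in (0 : ℝ)..x, g y) (g t) t := by
  have h : ∀ᵐ t : ℝ, ∀ n : ℕ, t ∈ uIcc 0 ((n : ℝ) + 1) → ∀ c ∈ uIcc 0 ((n : ℝ) + 1),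
      HasDerivAt (fun x => ∫ y in c..x, g y) (g t) t :=
    ae_all_iff.2 fun n => (hg (n + 1) (by positivity)).ae_hasDerivAt_integral
  refine (ae_restrict_iff' measurableSet_Ioi).2 ?_
  filter_upwards [h] with t ht ht0
  have ht0 : 0 < t := ht0
  obtain ⟨n, hn⟩ := exists_nat_ge t
  refine ht n ?_ 0 left_mem_uIcc
  rw [uIcc_of_le (by positivity)]
  exact ⟨ht0.le, by linarith⟩

end Primitive

/-! ### Construction of the Sonine partner -/

section Sonine

variable {k a b : ℝ → ℝ}

lemma HasLaplace.aestronglyMeasurable (hk : HasLaplace k) :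
    AEStronglyMeasurable k (volume.restrict (Ioi 0)) := by
  have h : AEStronglyMeasurable (fun t => Real.exp t * (Real.exp (-1 * t) * k t))
      (volume.restrict (Ioi 0)) :=
    Real.continuous_exp.aestronglyMeasurable.mul (hk 1 one_pos).1
  refine h.congr (ae_of_all _ fun t => ?_)
  simp only
  rw [← mul_assoc, ← Real.exp_add]
  simp

lemma HasLaplace.intervalIntegrable (hk : HasLaplace k) {T : ℝ} (hT : 0 < T) :
    IntervalIntegrable k volume 0 T := by
  rw [intervalIntegrable_iff_integrableOn_Ioc_of_le hT.le]
  have h1 := (hk 1 one_pos).mono_set (Ioc_subset_Ioi_self : Ioc 0 T ⊆ Ioi 0)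
  have h2 : IntegrableOn (fun t => Real.exp t * (Real.exp (-1 * t) * k t)) (Ioc 0 T) := by
    refine h1.bdd_mul (c := Real.exp T) (by fun_prop) ?_
    refine (ae_restrict_iff' measurableSet_Ioc).2 (ae_of_all _ fun t ht => ?_)
    rw [Real.norm_of_nonneg (Real.exp_pos _).le]
    exact Real.exp_le_exp.2 ht.2
  refine h2.congr (ae_of_all _ fun t => ?_)
  simp only
  rw [← mul_assoc, ← Real.exp_add]
  simp

/-- The splitting `e^{-pt} = e^{-ps} e^{-p(t-s)}`, written in the form of `posConvolution`, which
puts the reflected argument on the second factor. -/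
lemma conv_exp_mul (p : ℝ) (a b : ℝ → ℝ) (t : ℝ) :
    ∫ s in (0 : ℝ)..t, ContinuousLinearMap.mul ℝ ℝ (Real.exp (-p * s) * b s)
      (Real.exp (-p * (t - s)) * a (t - s)) = Real.exp (-p * t) * conv a b t := by
  rw [conv, ← intervalIntegral.integral_const_mul]
  refine intervalIntegral.integral_congr fun s _ => ?_
  simp only [ContinuousLinearMap.mul_apply']
  rw [show -p * t = -p * s + -p * (t - s) by ring, Real.exp_add]
  ring

lemma HasLaplace.conv (ha : HasLaplace a) (hb : HasLaplace b) : HasLaplace (conv a b) := by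
  intro p hp
  have h := integrable_posConvolution (hb p hp) (ha p hp) (ContinuousLinearMap.mul ℝ ℝ)
  rw [posConvolution, integrable_indicator_iff measurableSet_Ioi] at h
  simpa only [conv_exp_mul] using h

lemma laplace_conv (ha : HasLaplace a) (hb : HasLaplace b) {p : ℝ} (hp : 0 < p) :
    laplace (conv a b) p = laplace a p * laplace b p := by
  have h := integral_posConvolution (hb p hp) (ha p hp) (ContinuousLinearMap.mul ℝ ℝ)
  simp only [conv_exp_mul] at h
  rw [ContinuousLinearMap.mul_apply'] at h
  rw [laplace, h, mul_comm, laplace, laplace]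

lemma laplace_congr_ae (h : a =ᵐ[volume.restrict (Ioi 0)] b) (p : ℝ) :
    laplace a p = laplace b p :=
  integral_congr_ae (h.mono fun t ht => by simp only; rw [ht])

lemma hasLaplace_one : HasLaplace fun _ => 1 := fun p hp => by
  simpa only [mul_one] using integrableOn_exp_mul_Ioi (a := -p) (by linarith) 0

lemma laplace_one {p : ℝ} (hp : 0 < p) : laplace (fun _ => 1) p = p⁻¹ := by
  simpa only [laplace, mul_one] using integral_exp_neg_mul_Ioi hp

lemma integral_inv_add_nonneg (η : Measure ℝ) {p : ℝ} (hp : 0 < p) :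
    0 ≤ ∫ s in Ici (0 : ℝ), (p + s)⁻¹ ∂η :=
  setIntegral_nonneg measurableSet_Ici fun s (hs : 0 ≤ s) => by positivity

/-- The Laplace transform of an admissible kernel is a Stieltjes function without constant term;
the term `a / p` is absorbed into the measure as an atom at `0`. -/
lemma Admissible.exists_measure (hk : Admissible k) :
    ∃ σ : Measure ℝ, IntegrableOn (fun s : ℝ => (1 + s)⁻¹) (Ici 0) σ ∧
      ∀ p : ℝ, 0 < p → laplace k p = ∫ s in Ici (0 : ℝ), (p + s)⁻¹ ∂σ := by
  obtain ⟨c, b, σ, hc, hb, hσ, hK⟩ := hk.stieltjes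
  -- `K(p) ≥ b` for all `p > 0`, while `K → 0` at infinity.
  have hb0 : b ≤ 0 := by
    refine ge_of_tendsto hk.laplace_top ?_
    filter_upwards [eventually_gt_atTop 0] with p hp
    rw [hK p hp]
    have := integral_inv_add_nonneg σ hp
    have : 0 ≤ c / p := by positivity
    linarith
  have hb' : b = 0 := le_antisymm hb0 hb
  have hdirac : (Measure.dirac (0 : ℝ)).restrict (Ici 0) = Measure.dirac 0 := by
    rw [restrict_dirac' measurableSet_Ici, if_pos (mem_Ici.2 le_rfl)]
  have hatom : ∀ p : ℝ, Integrable (fun s : ℝ => (p + s)⁻¹)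
      ((ENNReal.ofReal c • Measure.dirac (0 : ℝ)).restrict (Ici 0)) := fun p => by
    rw [Measure.restrict_smul, hdirac]
    exact (integrable_dirac (by finiteness)).smul_measure ENNReal.ofReal_ne_top
  refine ⟨σ + ENNReal.ofReal c • Measure.dirac 0, ?_, fun p hp => ?_⟩
  · rw [IntegrableOn, Measure.restrict_add]
    exact Integrable.add_measure hσ (hatom 1)
  · rw [hK p hp, Measure.restrict_add,
      integral_add_measure (integrableOn_inv_add hσ hp) (hatom p), Measure.restrict_smul, hdirac,
      integral_smul_measure, integral_dirac, ENNReal.toReal_ofReal hc, hb', smul_eq_mul]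
    ring

/-- A zero of `K` at one point would make `σ` vanish on `[0,∞)`, hence `K` vanish identically,
against `K → ∞` at `0`. -/
lemma Admissible.laplace_pos (hk : Admissible k) {p : ℝ} (hp : 0 < p) : 0 < laplace k p := by
  obtain ⟨σ, hσ, hK⟩ := hk.exists_measure
  rw [hK p hp]
  refine (integral_inv_add_nonneg σ hp).lt_of_ne fun h0 => ?_
  have hz : σ.restrict (Ici 0) = 0 := by
    have h1 := (integral_eq_zero_iff_of_nonneg_ae
      ((ae_restrict_iff' measurableSet_Ici).2 (ae_of_all _ fun s (hs : 0 ≤ s) => by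
        simp only [Pi.zero_apply]; positivity)) (integrableOn_inv_add hσ hp)).1 h0.symm
    rw [← ae_eq_bot, ← eventually_false_iff_eq_bot]
    filter_upwards [h1, ae_restrict_mem measurableSet_Ici] with s h2 hs
    have hs : 0 ≤ s := hs
    have : 0 < (p + s)⁻¹ := by positivity
    exact this.ne' h2
  obtain ⟨q, hq1, hq0⟩ := ((hk.laplace_zero.eventually_gt_atTop 0).and
    (self_mem_nhdsWithin : Ioi (0 : ℝ) ∈ 𝓝[>] 0)).exists
  rw [hK q hq0, hz, integral_zero_measure] at hq1
  exact lt_irrefl _ hq1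

/-- An admissible kernel has a Sonine partner, the exponential integral of the measure representing
`1 / (p K(p))`. -/
theorem Admissible.exists_sonine (hk : Admissible k) :
    ∃ η : Measure ℝ, IntegrableOn (fun s : ℝ => (1 + s)⁻¹) (Ici 0) η ∧
      (∀ p : ℝ, 0 < p → 1 / (p * laplace k p) = ∫ s in Ici (0 : ℝ), (p + s)⁻¹ ∂η) ∧
      ∀ t : ℝ, 0 < t → conv k (expIntegral η) t = 1 := by
  obtain ⟨σ, hσ, hK⟩ := hk.exists_measure
  obtain ⟨b, η, hb, hη, hdual⟩ := exists_stieltjes_dual hσ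
    (by rw [← hK 1 one_pos]; exact hk.laplace_pos one_pos)
  have hb0 : b ≤ 0 := by
    have hlim : Tendsto (fun p => 1 / (p * laplace k p)) atTop (𝓝 0) :=
      tendsto_const_nhds.div_atTop hk.mul_laplace_top
    refine ge_of_tendsto hlim ?_
    filter_upwards [eventually_gt_atTop 0] with p hp
    rw [hK p hp, hdual p hp]
    exact le_add_of_nonneg_right (integral_inv_add_nonneg η hp)
  have hdual' : ∀ p : ℝ, 0 < p →
      1 / (p * laplace k p) = ∫ s in Ici (0 : ℝ), (p + s)⁻¹ ∂η := fun p hp => by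
    rw [hK p hp, hdual p hp, le_antisymm hb0 hb, zero_add]
  have hL : HasLaplace (expIntegral η) := fun p hp => (laplace_expIntegral hη hp).1
  have hLσ : HasLaplace (expIntegral σ) := fun p hp => (laplace_expIntegral hσ hp).1
  -- `k` itself need not be monotone or continuous; its almost everywhere equal version is, and
  -- convolutions do not see the difference.
  have hkσ : k =ᵐ[volume.restrict (Ioi 0)] expIntegral σ :=
    ae_eq_of_laplace_eq hk.hasLaplace hLσ hk.nonneg (fun t _ => expIntegral_nonneg t)
      fun p hp => by rw [hK p hp, (laplace_expIntegral hσ hp).2]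
  have hae : conv (expIntegral σ) (expIntegral η) =ᵐ[volume.restrict (Ioi 0)] fun _ => 1 := by
    refine ae_eq_of_laplace_eq (hLσ.conv hL) hasLaplace_one
      (fun t ht => conv_nonneg (fun s _ => expIntegral_nonneg s) (fun s _ => expIntegral_nonneg s)
        ht.le) (fun _ _ => zero_le_one) fun p hp => ?_
    rw [laplace_conv hLσ hL hp, ← laplace_congr_ae hkσ, (laplace_expIntegral hη hp).2,
      ← hdual' p hp, laplace_one hp]
    have := (hk.laplace_pos hp).ne'
    field_simp
  have h1 := conv_eq_one_of_ae (fun s _ => expIntegral_nonneg s) (fun s _ => expIntegral_nonneg s)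
    (antitoneOn_expIntegral hσ) (antitoneOn_expIntegral hη) (continuousOn_expIntegral hσ)
    (continuousOn_expIntegral hη) hae
  refine ⟨η, hη, hdual', fun t ht => ?_⟩
  rw [conv_congr_ae hkσ (ae_eq_refl _) ht.le]
  exact h1 ht

end Sonine

/-! ### The fractional derivative and integral as mutual inverses -/

section FractionalCalculus

variable {k ϰ f u : ℝ → ℝ}

lemma LocBddMeasurable.intervalIntegrable (hf : LocBddMeasurable f) {T : ℝ} (hT : 0 < T) :
    IntervalIntegrable f volume 0 T := by
  obtain ⟨C, hC⟩ := hf.2 T hT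
  simpa using intervalIntegrable_mul_bdd (a := fun _ => 1) intervalIntegrable_const hT.le hf.1 hC

/-- Associativity with `k * ϰ = 1`, whose value also supplies the bound `C = 1` and the
integrability that `conv_assoc` requires. -/
lemma conv_conv_of_sonine (hk : HasLaplace k) (hϰ : HasLaplace ϰ)
    (hk0 : ∀ s, 0 < s → 0 ≤ k s) (hϰ0 : ∀ s, 0 < s → 0 ≤ ϰ s)
    (hS : ∀ t, 0 < t → conv k ϰ t = 1) {t : ℝ} (ht : 0 < t)
    (hf : IntervalIntegrable f volume 0 t) :
    IntervalIntegrable (fun s => k (t - s) * conv ϰ f s) volume 0 t ∧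
      conv k (conv ϰ f) t = ∫ s in (0 : ℝ)..t, f s := by
  obtain ⟨h1, h2⟩ := conv_assoc (C := 1) ht hk.aestronglyMeasurable hϰ.aestronglyMeasurable hk0 hϰ0
    (fun τ hτ _ => ⟨intervalIntegrable_of_conv_ne_zero (by rw [hS τ hτ]; exact one_ne_zero),
      (hS τ hτ).le⟩) hf
  refine ⟨h1, h2.trans ?_⟩
  have hone : conv k ϰ =ᵐ[volume.restrict (Ioi 0)] fun _ => 1 :=
    (ae_restrict_iff' measurableSet_Ioi).2 (ae_of_all _ hS)
  rw [conv_congr_ae hone (ae_eq_refl f) ht.le, conv]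
  simp only [one_mul]

/-- `k * (ϰ * f)` is the primitive of `f`, and the term `k(t) u(0)` vanishes because the fractional
integral is `0` at `0`. -/
theorem fracDeriv_fracInt (hk : HasLaplace k) (hϰ : HasLaplace ϰ)
    (hk0 : ∀ s, 0 < s → 0 ≤ k s) (hϰ0 : ∀ s, 0 < s → 0 ≤ ϰ s) (hanti : AntitoneOn ϰ (Ioi 0))
    (hS : ∀ t, 0 < t → conv k ϰ t = 1) (hf : LocBddMeasurable f) :
    InDomain k (fracInt ϰ f) ∧
      ∀ᵐ t ∂(volume.restrict (Ioi (0 : ℝ))), fracDeriv k (fracInt ϰ f) t = f t := by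
  have hder : ∀ᵐ t ∂(volume.restrict (Ioi (0 : ℝ))),
      HasDerivAt (conv k (fracInt ϰ f)) (f t) t := by
    filter_upwards [ae_hasDerivAt_primitive fun T hT => hf.intervalIntegrable hT,
      ae_restrict_mem measurableSet_Ioi] with t ht ht0
    refine ht.congr_of_eventuallyEq ?_
    filter_upwards [Ioi_mem_nhds ht0] with x hx
    exact (conv_conv_of_sonine hk hϰ hk0 hϰ0 hS hx (hf.intervalIntegrable hx)).2
  refine ⟨⟨continuousOn_conv hϰ0 hanti (fun T hT => hϰ.intervalIntegrable hT) hf,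
    hder.mono fun t ht => ht.differentiableAt⟩, hder.mono fun t ht => ?_⟩
  rw [fracDeriv, ht.deriv, fracInt, conv_zero, mul_zero, sub_zero]

lemma AbsContHalfLine.intervalIntegrable_deriv (hu : AbsContHalfLine u) {T : ℝ} (hT : 0 < T) :
    IntervalIntegrable (deriv u) volume 0 T :=
  (hu T hT).intervalIntegrable_deriv

lemma AbsContHalfLine.continuousOn (hu : AbsContHalfLine u) : ContinuousOn u (Ici 0) := by
  intro t ht
  have ht : 0 ≤ t := ht
  have h := (hu (t + 1) (by linarith)).continuousOn t
    (by rw [uIcc_of_le (by linarith)]; exact ⟨ht, by linarith⟩)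
  rw [uIcc_of_le (by linarith), ← Ici_inter_Iic] at h
  exact (continuousWithinAt_inter (Iic_mem_nhds (by linarith))).1 h

/-- For `u` absolutely continuous, `k * u` is the primitive of `u(0) k + k * u'`. -/
theorem conv_of_absCont (hk : HasLaplace k) (hk0 : ∀ s, 0 < s → 0 ≤ k s)
    (hu : AbsContHalfLine u) {t : ℝ} (ht : 0 < t) :
    IntervalIntegrable (conv k (deriv u)) volume 0 t ∧
      conv k u t = ∫ s in (0 : ℝ)..t, (u 0 * k s + conv k (deriv u) s) := by
  have hu' := hu.intervalIntegrable_deriv ht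
  have hone : AEStronglyMeasurable (fun _ : ℝ => (1 : ℝ)) (volume.restrict (Ioi 0)) :=
    aestronglyMeasurable_const
  have hconv : ∀ τ, conv (fun _ => 1) k τ = ∫ s in (0 : ℝ)..τ, k s := fun τ => by
    simp only [conv, one_mul]
  have hint : ∀ τ, 0 < τ → IntervalIntegrable (fun s => (fun _ => (1 : ℝ)) (τ - s) * k s)
      volume 0 τ := fun τ hτ => by simpa only [one_mul] using hk.intervalIntegrable hτ
  have hle : ∀ τ, 0 < τ → τ ≤ t → conv (fun _ => 1) k τ ≤ ∫ s in (0 : ℝ)..t, k s :=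
    fun τ hτ hτt => by
      rw [hconv]
      refine intervalIntegral.integral_mono_interval le_rfl hτ.le hτt ?_ (hk.intervalIntegrable ht)
      exact (ae_restrict_iff' measurableSet_Ioc).2 (ae_of_all _ fun s hs => hk0 s hs.1)
  -- Two uses of associativity: `1 * (k * u')` and `k * (1 * u')` both equal `(1 * k) * u'`, and `1
  -- * u' = u - u(0)`.
  obtain ⟨h1, h2⟩ := conv_assoc ht hone hk.aestronglyMeasurable (fun _ _ => zero_le_one) hk0
    (fun τ hτ hτt => ⟨hint τ hτ, hle τ hτ hτt⟩) hu'
  obtain ⟨h3, h4⟩ := conv_assoc ht hk.aestronglyMeasurable hone hk0 (fun _ _ => zero_le_one)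
    (fun τ hτ hτt => ⟨intervalIntegrable_conv_comm (hint τ hτ),
      (conv_comm _ _ _).trans_le (hle τ hτ hτt)⟩) hu'
  simp only [one_mul] at h1
  refine ⟨h1, ?_⟩
  have hk' : IntervalIntegrable (fun s => k (t - s)) volume 0 t := by
    simpa using ((hk.intervalIntegrable ht).comp_sub_left t).symm
  have hrep : ∀ s ∈ uIcc 0 t,
      k (t - s) * u s = u 0 * k (t - s) + k (t - s) * conv (fun _ => 1) (deriv u) s := by
    intro s hs
    rw [uIcc_of_le ht.le] at hs
    have : conv (fun _ => 1) (deriv u) s = u s - u 0 := by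
      simp only [conv, one_mul]
      rcases hs.1.eq_or_lt with rfl | h
      · simp
      · exact (hu s h).integral_deriv_eq_sub
    rw [this]; ring
  have hcomm : conv k (fun _ => 1) = conv (fun _ => 1) k := funext fun τ => conv_comm _ _ _
  have hconv1 : conv (fun _ => 1) (conv k (deriv u)) t =
      ∫ s in (0 : ℝ)..t, conv k (deriv u) s := by
    simp only [conv, one_mul]
  rw [conv, intervalIntegral.integral_congr hrep,
    intervalIntegral.integral_add (hk'.const_mul _) h3, intervalIntegral.integral_const_mul,
    intervalIntegral.integral_comp_sub_left (fun s => k s), sub_self, sub_zero,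
    intervalIntegral.integral_add ((hk.intervalIntegrable ht).const_mul _) h1,
    intervalIntegral.integral_const_mul]
  congr 1
  rw [← hconv1, h2, ← hcomm, ← h4, conv]

theorem hasDerivAt_conv_of_absCont (hk : HasLaplace k) (hk0 : ∀ s, 0 < s → 0 ≤ k s)
    (hu : AbsContHalfLine u) :
    ∀ᵐ t ∂(volume.restrict (Ioi (0 : ℝ))),
      HasDerivAt (conv k u) (u 0 * k t + conv k (deriv u) t) t := by
  filter_upwards [ae_hasDerivAt_primitive fun T hT =>
      ((hk.intervalIntegrable hT).const_mul (u 0)).add (conv_of_absCont hk hk0 hu hT).1,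
    ae_restrict_mem measurableSet_Ioi] with t ht ht0
  refine ht.congr_of_eventuallyEq ?_
  filter_upwards [Ioi_mem_nhds ht0] with x hx
  exact (conv_of_absCont hk hk0 hu hx).2

theorem fracDeriv_ae_eq_conv_deriv (hk : HasLaplace k) (hk0 : ∀ s, 0 < s → 0 ≤ k s)
    (hu : AbsContHalfLine u) :
    fracDeriv k u =ᵐ[volume.restrict (Ioi 0)] conv k (deriv u) := by
  filter_upwards [hasDerivAt_conv_of_absCont hk hk0 hu] with t ht
  rw [fracDeriv, ht.deriv]
  ring

theorem fracInt_fracDeriv (hk : HasLaplace k) (hϰ : HasLaplace ϰ)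
    (hk0 : ∀ s, 0 < s → 0 ≤ k s) (hϰ0 : ∀ s, 0 < s → 0 ≤ ϰ s)
    (hS : ∀ t, 0 < t → conv k ϰ t = 1) (hu : AbsContHalfLine u) {t : ℝ} (ht : 0 ≤ t) :
    IntervalIntegrable (fun s => ϰ (t - s) * fracDeriv k u s) volume 0 t ∧
      fracInt ϰ (fracDeriv k u) t = u t - u 0 := by
  rcases ht.eq_or_lt with rfl | ht
  · exact ⟨IntervalIntegrable.refl, by rw [fracInt, conv_zero, sub_self]⟩
  have hae := fracDeriv_ae_eq_conv_deriv hk hk0 hu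
  -- The Sonine relation is symmetric, so `k` and `ϰ` exchange roles: `ϰ * (k * u') = 1 * u'`.
  obtain ⟨h1, h2⟩ := conv_conv_of_sonine hϰ hk hϰ0 hk0
    (fun t ht => (conv_comm _ _ _).trans (hS t ht)) ht (hu.intervalIntegrable_deriv ht)
  refine ⟨h1.congr_ae ?_, ?_⟩
  · rw [uIoc_of_le ht.le]
    filter_upwards [ae_restrict_of_ae_restrict_of_subset Ioc_subset_Ioi_self hae] with s hs
    rw [hs]
  · rw [fracInt, conv_congr_ae (ae_eq_refl ϰ) hae ht.le, h2, (hu t ht).integral_deriv_eq_sub]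

end FractionalCalculus

end GenFrac

theorem theorem1 (k : ℝ → ℝ) (hk : GenFrac.Admissible k) :
    GenFrac.IsStieltjes (fun p : ℝ => 1 / (p * GenFrac.laplace k p)) ∧
    ∃ ϰ : ℝ → ℝ,
      GenFrac.CompletelyMonotone ϰ ∧
      -- `ϰ` comes from the Stieltjes representation of `1 / (p K(p))`
      (∃ η : Measure ℝ,
        IntegrableOn (fun s : ℝ => (1 + s)⁻¹) (Ici 0) η ∧
        (∀ p : ℝ, 0 < p →
          1 / (p * GenFrac.laplace k p) = ∫ s in Ici (0 : ℝ), (p + s)⁻¹ ∂η) ∧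
        (∀ t : ℝ, 0 < t →
          IntegrableOn (fun s : ℝ => Real.exp (-t * s)) (Ici 0) η ∧
          ϰ t = ∫ s in Ici (0 : ℝ), Real.exp (-t * s) ∂η)) ∧
      GenFrac.HasLaplace ϰ ∧
      (∀ p : ℝ, 0 < p → GenFrac.laplace ϰ p = 1 / (p * GenFrac.laplace k p)) ∧
      -- `k` and `ϰ` are a Sonine pair
      (∀ t : ℝ, 0 < t → GenFrac.conv k ϰ t = 1) ∧
      -- the fractional integral is a right inverse of the fractional derivative
      (∀ f : ℝ → ℝ, GenFrac.LocBddMeasurable f →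
        (∀ t : ℝ, 0 < t → IntervalIntegrable (fun s : ℝ => ϰ (t - s) * f s) volume 0 t) ∧
        GenFrac.InDomain k (GenFrac.fracInt ϰ f) ∧
        ∀ᵐ t ∂(volume.restrict (Ioi (0 : ℝ))),
          GenFrac.fracDeriv k (GenFrac.fracInt ϰ f) t = f t) ∧
      -- the fractional integral of the fractional derivative
      (∀ u : ℝ → ℝ, GenFrac.AbsContHalfLine u →
        GenFrac.InDomain k u ∧
        (∀ T : ℝ, 0 < T → IntegrableOn (GenFrac.fracDeriv k u) (Ioc 0 T)) ∧
        ∀ t : ℝ, 0 ≤ t →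
          IntervalIntegrable (fun s : ℝ => ϰ (t - s) * GenFrac.fracDeriv k u s) volume 0 t ∧
          GenFrac.fracInt ϰ (GenFrac.fracDeriv k u) t = u t - u 0) := by
  obtain ⟨η, hη, hdual, hS⟩ := hk.exists_sonine
  have hL : GenFrac.HasLaplace (GenFrac.expIntegral η) := fun p hp =>
    (GenFrac.laplace_expIntegral hη hp).1
  have hϰ0 : ∀ s, 0 < s → 0 ≤ GenFrac.expIntegral η s := fun s _ =>
    GenFrac.expIntegral_nonneg s
  refine ⟨⟨0, 0, η, le_rfl, le_rfl, hη, fun p hp => by simpa using hdual p hp⟩,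
    GenFrac.expIntegral η, GenFrac.completelyMonotone_expIntegral hη,
    ⟨η, hη, hdual, fun t ht => ⟨GenFrac.integrableOn_exp hη ht, rfl⟩⟩, hL,
    fun p hp => by rw [(GenFrac.laplace_expIntegral hη hp).2, hdual p hp], hS,
    fun f hf => ⟨fun t ht => ?_, GenFrac.fracDeriv_fracInt hk.hasLaplace hL hk.nonneg hϰ0
      (GenFrac.antitoneOn_expIntegral hη) hS hf⟩,
    fun u hu => ⟨⟨hu.continuousOn, ?_⟩, fun T hT => ?_, fun t ht =>
      GenFrac.fracInt_fracDeriv hk.hasLaplace hL hk.nonneg hϰ0 hS hu ht⟩⟩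
  · obtain ⟨C, hC⟩ := hf.2 t ht
    exact GenFrac.intervalIntegrable_mul_bdd (hL.intervalIntegrable ht) ht.le hf.1 hC
  · exact (GenFrac.hasDerivAt_conv_of_absCont hk.hasLaplace hk.nonneg hu).mono
      fun t ht => ht.differentiableAt
  · have h := (GenFrac.conv_of_absCont hk.hasLaplace hk.nonneg hu hT).1
    rw [intervalIntegrable_iff_integrableOn_Ioc_of_le hT.le] at h
    exact h.congr (ae_restrict_of_ae_restrict_of_subset Ioc_subset_Ioi_self
      (GenFrac.fracDeriv_ae_eq_conv_deriv hk.hasLaplace hk.nonneg hu).symm)
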